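/- **Setting.** Let $m,n\ge 1$ be integers, $\tau>0$, and let $\Delta_h\in\mathbb R^{m\times m}$ be such that $-\Delta_h$ is symmetric positive definite. Put $L=I_m-\frac{\tau^2}{2}\Delta_h$. For real $\alpha$ let $$\mathcal C_\alpha=B_1^{(\alpha)}\otimes L+B_2^{(\alpha)}\otimes(-2I_m),$$ where $B_1^{(\alpha)}\in\mathbb R^{n\times n}$ is the $\alpha$-circulant matrix with ones on the main diagonal and on the second subdiagonal and $\alpha$ at the wrapped-around positions of the second subdiagonal, and $B_2^{(\alpha)}\in\mathbb R^{n\times n}$ is the $\alpha$-circulant matrix with ones on the first subdiagonal and $\alpha$ at its wrapped-around position (contributions falling on the same entry are added). Let $\mathcal T=\mathcal C_0$ be the all-at-once matrix, block lower triangular Toeplitz with $L$ on the main and second block subdiagonals and $-2I_m$ on the first block subdiagonal. Let $\mathcal Y=Y_n\otimes I_m$, where $Y_n$ is the $n\times n$ anti-identity matrix. For $\alpha\in(0,1/2]$ the matrix $\mathcal C_\alpha$ is diagonalizable over $\mathbb C$, $\mathcal C_\alpha=X^{-1}\operatorname{diag}(\mu_i)X$; put $\mathcal C_\alpha^{1/2}=X^{-1}\operatorname{diag}(\sqrt{\mu_i})X$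 (principal branch), which is invertible and independent of the choice of $X$, and $\mathcal P_\alpha=(\mathcal C_\alpha^{1/2})^{T}\mathcal C_\alpha^{1/2}$. Define $$c_0=\sup_{\alpha\in(0,1/2]}\big\|\mathcal C_\alpha^{-1/2}\big\|_2^2,\qquad c_1=c_0\Big(\sqrt{\|L\|_2^2+1}+1\Big),$$ with $\|\cdot\|_2$ the spectral norm; here $c_0<\infty$ and $c_1>0$. **Theorem.** Fix any $\nu\in(0,1)$ and let $\eta=\min\{\nu^2/c_1,\,1/2\}$. For every $\alpha\in(0,\eta]$ the matrix $\mathcal P_\alpha$ is real and symmetric positive definite, and for every right-hand side $\mathbf f\in\mathbb R^{mn}$ and every initial guess $\mathbf u_0\in\mathbb R^{mn}$ the iterates $\mathbf u_k$ of MINRES with preconditioner $\mathcal P_\alpha$ for the system $\mathcal Y\mathcal T\mathbf u=\mathcal Y\mathbf f$ are well defined and satisfy $$\|\tilde{\mathbf r}_k\|_{\mathcal P_\alpha}\le 2\nu^{k-1}\,\|\tilde{\mathbf r}_0\|_{\mathcal P_\alpha}\qquad\text{for all }k\ge 1,$$ where $\tilde{\mathbf r}_k=\mathcal P_\alpha^{-1}\mathcal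 Y\mathcal T\mathbf u_k-\mathcal P_\alpha^{-1}\mathcal Y\mathbf f$ and $\|\mathbf v\|_{\mathcal P_\alpha}=(\mathbf v^T\mathcal P_\alpha\mathbf v)^{1/2}$, so that $\|\tilde{\mathbf r}_k\|_{\mathcal P_\alpha}=\|\mathcal P_\alpha^{-1/2}(\mathcal Y\mathcal T\mathbf u_k-\mathcal Y\mathbf f)\|_2$. Here $\mathbf u_k$ is the element of $\mathbf u_0+\operatorname{span}\{G^j\tilde{\mathbf r}_0:0\le j<k\}$, $G=\mathcal P_\alpha^{-1}\mathcal Y\mathcal T$, for which $\|\tilde{\mathbf r}_k\|_{\mathcal P_\alpha}$ is smallest. In particular the bound $2\nu^{k-1}$ depends neither on $\tau$ nor on $\Delta_h$ (hence not on $h$), $m$, $n$. -/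

import Mathlib

open Matrix
open scoped Kronecker

noncomputable section

/-- The spectral norm of a square matrix: the operator norm for the Euclidean vector norms. -/
def specNorm {𝕜 ι : Type*} [RCLike 𝕜] [Fintype ι] [DecidableEq ι] (A : Matrix ι ι 𝕜) : ℝ :=
  ‖Matrix.toEuclideanCLM (𝕜 := 𝕜) A‖

/-- `S` is a principal square root of the diagonalizable complex matrix `A`:
`A = X⁻¹ diag(μ) X` and `S = X⁻¹ diag(√μ) X` with the principal branch of the square root. -/
def IsPrincipalSqrt {ι : Type*} [Fintype ι] [DecidableEq ι] (A S : Matrix ι ι ℂ) : Prop :=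
  ∃ (X : Matrix ι ι ℂ) (μ : ι → ℂ), IsUnit X.det ∧
    A = X⁻¹ * Matrix.diagonal μ * X ∧
    S = X⁻¹ * Matrix.diagonal (fun i => μ i ^ (1 / 2 : ℂ)) * X

/-- The principal square root does not depend on the chosen diagonalization. -/
theorem IsPrincipalSqrt.unique {ι : Type*} [Fintype ι] [DecidableEq ι] {A S S' : Matrix ι ι ℂ}
    (h : IsPrincipalSqrt A S) (h' : IsPrincipalSqrt A S') : S = S' := by
  obtain ⟨X, d, hX, hA, hS⟩ := h
  obtain ⟨Z, e, hZ, hA', hS'⟩ := h'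
  have hXX : X * X⁻¹ = 1 := Matrix.mul_nonsing_inv X hX
  have hX' : X⁻¹ * X = 1 := Matrix.nonsing_inv_mul X hX
  have hZZ : Z * Z⁻¹ = 1 := Matrix.mul_nonsing_inv Z hZ
  have hZ' : Z⁻¹ * Z = 1 := Matrix.nonsing_inv_mul Z hZ
  have key : (Z * X⁻¹) * Matrix.diagonal d = Matrix.diagonal e * (Z * X⁻¹) := by
    have h1 : Z * A * X⁻¹ = (Z * X⁻¹) * Matrix.diagonal d := by
      rw [hA]
      calc Z * (X⁻¹ * Matrix.diagonal d * X) * X⁻¹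
          = (Z * X⁻¹) * Matrix.diagonal d * (X * X⁻¹) := by simp only [Matrix.mul_assoc]
        _ = _ := by rw [hXX, Matrix.mul_one]
    have h2 : Z * A * X⁻¹ = Matrix.diagonal e * (Z * X⁻¹) := by
      rw [hA']
      calc Z * (Z⁻¹ * Matrix.diagonal e * Z) * X⁻¹
          = (Z * Z⁻¹) * (Matrix.diagonal e * (Z * X⁻¹)) := by simp only [Matrix.mul_assoc]
        _ = _ := by rw [hZZ, Matrix.one_mul]
    rw [← h1, h2]
  have key' : (Z * X⁻¹) * Matrix.diagonal (fun i => d i ^ (1 / 2 : ℂ))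
      = Matrix.diagonal (fun i => e i ^ (1 / 2 : ℂ)) * (Z * X⁻¹) := by
    ext i j
    have hij := congrFun (congrFun key i) j
    rw [Matrix.mul_diagonal, Matrix.diagonal_mul] at hij ⊢
    by_cases hw : (Z * X⁻¹) i j = 0
    · rw [hw]; ring
    · have hde : d j = e i := mul_left_cancel₀ hw (by rw [hij]; ring)
      rw [hde]; ring
  rw [hS, hS']
  calc X⁻¹ * Matrix.diagonal (fun i => d i ^ (1 / 2 : ℂ)) * X
      = (Z⁻¹ * Z) * (X⁻¹ * Matrix.diagonal (fun i => d i ^ (1 / 2 : ℂ)) * X) := by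
        rw [hZ', Matrix.one_mul]
    _ = Z⁻¹ * ((Z * X⁻¹) * Matrix.diagonal (fun i => d i ^ (1 / 2 : ℂ))) * X := by
        simp only [Matrix.mul_assoc]
    _ = Z⁻¹ * (Matrix.diagonal (fun i => e i ^ (1 / 2 : ℂ)) * (Z * X⁻¹)) * X := by rw [key']
    _ = Z⁻¹ * Matrix.diagonal (fun i => e i ^ (1 / 2 : ℂ)) * Z * (X⁻¹ * X) := by
        simp only [Matrix.mul_assoc]
    _ = _ := by rw [hX', Matrix.mul_one]

open Classical in
/-- The principal square root of a diagonalizable complex matrix (zero if `A` is not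
diagonalizable). -/
def principalSqrt {ι : Type*} [Fintype ι] [DecidableEq ι] (A : Matrix ι ι ℂ) : Matrix ι ι ℂ :=
  if h : ∃ S, IsPrincipalSqrt A S then h.choose else 0

namespace WaveMinres

variable {m : ℕ}

/-- `L = I - (τ² / 2) Δ_h`. -/
def waveL (τ : ℝ) (Δh : Matrix (Fin m) (Fin m) ℝ) : Matrix (Fin m) (Fin m) ℝ :=
  1 - (τ ^ 2 / 2) • Δh

/-- The `n × n` matrix with ones on the main diagonal and on the second subdiagonal, and with `α`
at the two (cyclically continued) places of the second subdiagonal in the top right corner. -/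
def timeB1 (n : ℕ) (α : ℝ) : Matrix (Fin n) (Fin n) ℝ :=
  Matrix.of fun i j =>
    (if i.val = j.val then 1 else 0) + (if i.val = j.val + 2 then 1 else 0)
      + (if i.val + n = j.val + 2 then α else 0)

/-- The `n × n` matrix with ones on the first subdiagonal and `α` in the top right corner. -/
def timeB2 (n : ℕ) (α : ℝ) : Matrix (Fin n) (Fin n) ℝ :=
  Matrix.of fun i j =>
    (if i.val = j.val + 1 then 1 else 0) + (if i.val + n = j.val + 1 then α else 0)

/-- The block `α`-circulant matrix `C_α = B₁ ⊗ L + B₂ ⊗ (-2 I)`, of block order `n`. -/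
def blockC (n : ℕ) (L : Matrix (Fin m) (Fin m) ℝ) (α : ℝ) :
    Matrix (Fin n × Fin m) (Fin n × Fin m) ℝ :=
  timeB1 n α ⊗ₖ L + timeB2 n α ⊗ₖ ((-2 : ℝ) • (1 : Matrix (Fin m) (Fin m) ℝ))

/-- The all-at-once block lower triangular Toeplitz matrix `T`, with `L` on the main block diagonal
and on the second block subdiagonal and `-2 I` on the first one (no wrap-around terms). -/
def blockT (n : ℕ) (L : Matrix (Fin m) (Fin m) ℝ) :
    Matrix (Fin n × Fin m) (Fin n × Fin m) ℝ :=
  blockC n L 0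

/-- The anti-identity matrix. -/
def antiId (n : ℕ) : Matrix (Fin n) (Fin n) ℝ :=
  Matrix.of fun i j => if i.val + j.val + 1 = n then 1 else 0

/-- `Y = Y_n ⊗ I`. -/
def blockY (m n : ℕ) : Matrix (Fin n × Fin m) (Fin n × Fin m) ℝ :=
  antiId n ⊗ₖ (1 : Matrix (Fin m) (Fin m) ℝ)

/-- `C_α` regarded as a complex matrix. -/
def blockCℂ (n : ℕ) (L : Matrix (Fin m) (Fin m) ℝ) (α : ℝ) :
    Matrix (Fin n × Fin m) (Fin n × Fin m) ℂ :=
  (blockC n L α).map Complex.ofReal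

/-- `C_α^{1/2}`. -/
def sqrtC (n : ℕ) (L : Matrix (Fin m) (Fin m) ℝ) (α : ℝ) :
    Matrix (Fin n × Fin m) (Fin n × Fin m) ℂ :=
  principalSqrt (blockCℂ n L α)

/-- The preconditioner `P_α = (C_α^{1/2})ᵀ C_α^{1/2}`, as a real matrix. (That the complex product
has real entries is part of the theorem, so that taking real parts loses nothing.) -/
def precP (n : ℕ) (L : Matrix (Fin m) (Fin m) ℝ) (α : ℝ) :
    Matrix (Fin n × Fin m) (Fin n × Fin m) ℝ :=
  ((sqrtC n L α)ᵀ * sqrtC n L α).map Complex.re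

/-- The numbers `‖C_α^{-1/2}‖₂²` for `α ∈ (0, 1/2]`. -/
def c0Set (n : ℕ) (L : Matrix (Fin m) (Fin m) ℝ) : Set ℝ :=
  (fun α : ℝ => specNorm (sqrtC n L α)⁻¹ ^ 2) '' Set.Ioc 0 (1 / 2)

/-- `c₀ = sup_{α ∈ (0, 1/2]} ‖C_α^{-1/2}‖₂²`. -/
def c0 (n : ℕ) (L : Matrix (Fin m) (Fin m) ℝ) : ℝ := sSup (c0Set n L)

/-- `c₁ = c₀ (√(‖L‖₂² + 1) + 1)`. -/
def c1 (n : ℕ) (L : Matrix (Fin m) (Fin m) ℝ) : ℝ :=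
  c0 n L * (Real.sqrt (specNorm L ^ 2 + 1) + 1)

/-- `η = min {ν² / c₁, 1/2}`. -/
def eta (n : ℕ) (L : Matrix (Fin m) (Fin m) ℝ) (ν : ℝ) : ℝ := min (ν ^ 2 / c1 n L) (1 / 2)

end WaveMinres

section Minres

variable {ι : Type*} [Fintype ι] [DecidableEq ι]

/-- The norm `‖v‖_P = √(vᵀ P v)` of a symmetric positive definite matrix `P`. -/
def energyNorm (P : Matrix ι ι ℝ) (v : ι → ℝ) : ℝ := Real.sqrt (v ⬝ᵥ (P *ᵥ v))

/-- The residual `P⁻¹ A u - P⁻¹ b` of the preconditioned system `P⁻¹ A u = P⁻¹ b`. -/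
def precResidual (P A : Matrix ι ι ℝ) (b u : ι → ℝ) : ι → ℝ :=
  P⁻¹ *ᵥ (A *ᵥ u) - P⁻¹ *ᵥ b

/-- The Krylov space spanned by `r, G r, …, G^(k-1) r`. -/
def krylov (G : Matrix ι ι ℝ) (r : ι → ℝ) (k : ℕ) : Submodule ℝ (ι → ℝ) :=
  Submodule.span ℝ (Set.range fun j : Fin k => (G ^ (j : ℕ)) *ᵥ r)

/-- `u` is the `k`-th iterate of MINRES for `A u = b` (`A` symmetric) with the symmetric positive
definite preconditioner `P` and initial guess `u₀`: in `u₀ + K_k(P⁻¹ A, r₀)` it has the smallest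
preconditioned residual, in the norm `‖·‖_P` of the inner product for which `P⁻¹ A` is
self-adjoint. Equivalently, it minimizes `‖b - A u‖` in the norm `‖·‖_{P⁻¹}`. -/
def IsMinresIterate (P A : Matrix ι ι ℝ) (b u₀ : ι → ℝ) (k : ℕ) (u : ι → ℝ) : Prop :=
  u - u₀ ∈ krylov (P⁻¹ * A) (precResidual P A b u₀) k ∧
    ∀ v : ι → ℝ, v - u₀ ∈ krylov (P⁻¹ * A) (precResidual P A b u₀) k →
      energyNorm P (precResidual P A b u) ≤ energyNorm P (precResidual P A b v)

end Minres

end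

/-! Write R for `sqrtC n L α`. Toeplitz matrices are persymmetric and L is symmetric, so Y C_α Y =
C_αᵀ. The principal square root is unique and respects transposition and conjugation by an
involution, hence Y R Y = Rᵀ. The eigenvalues of C_α avoid the closed negative half-line, which
makes R real and invertible. Thus P_α = Rᵀ R is positive definite, and P_α⁻¹ Y T is similar, through
R, to the symmetric matrix Q = R⁻ᵀ Y T R⁻¹.

Since Y R² = Rᵀ Y R and C_α = T + α W, this matrix is Q = Y - α R⁻ᵀ Y W R⁻¹
(`precond_eq_blockY_sub`). Here Y is an isometry and the second term has norm at most α c₁ ≤ ν²,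
because ‖W‖ ≤ √(‖L‖² + 1) + 1 (`specNorm_wrapW_le`). So the eigenvalues of Q lie in ±[1 - ν², 1 +
ν²]. A Chebyshev polynomial in x² of degree at most 2⌊k/2⌋ with value 1 at 0 is bounded there by 2
(ν²)^⌊k/2⌋ ≤ 2 ν^(k-1), and the minimal residual can only be smaller.

The delicate point is c₀ < ∞ (`exists_specNorm_inv_sqrtC_le`): for n ≥ 2 the diagonalization of C_α
degenerates as α → 0. Instead, C_α^{-1/2} is written as a polynomial in B₂ of degree less than n, on
each eigenspace of L, with coefficients bounded uniformly in α. -/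

noncomputable section

/-! ### Principal square roots: symmetries and reality -/

section PrincipalSqrt

variable {ι : Type*} [Fintype ι] [DecidableEq ι] {A S : Matrix ι ι ℂ}

theorem IsPrincipalSqrt.isPrincipalSqrt_principalSqrt (h : IsPrincipalSqrt A S) :
    IsPrincipalSqrt A (principalSqrt A) := by
  have hex : ∃ S, IsPrincipalSqrt A S := ⟨S, h⟩
  rw [principalSqrt, dif_pos hex]
  exact hex.choose_spec

theorem IsPrincipalSqrt.mul_self (h : IsPrincipalSqrt A S) : S * S = A := by
  obtain ⟨X, d, hX, rfl, rfl⟩ := h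
  have hXX : X * X⁻¹ = 1 := Matrix.mul_nonsing_inv X hX
  calc _ = X⁻¹ * diagonal (fun i => d i ^ (1 / 2 : ℂ)) * (X * X⁻¹)
          * diagonal (fun i => d i ^ (1 / 2 : ℂ)) * X := by simp only [Matrix.mul_assoc]
    _ = X⁻¹ * (diagonal (fun i => d i ^ (1 / 2 : ℂ)) * diagonal (fun i => d i ^ (1 / 2 : ℂ)))
          * X := by rw [hXX]; simp only [Matrix.mul_assoc, Matrix.one_mul]
    _ = _ := by
      rw [diagonal_mul_diagonal]
      congr 3
      ext i
      have := Complex.cpow_nat_inv_pow (d i) (n := 2) two_ne_zero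
      rw [pow_two] at this
      simpa using this

/-- Used with `IsPrincipalSqrt.conj` and uniqueness to pass from Y C_α Y = C_αᵀ to the same identity
for the square root. -/
theorem IsPrincipalSqrt.transpose (h : IsPrincipalSqrt A S) : IsPrincipalSqrt Aᵀ Sᵀ := by
  obtain ⟨X, d, hX, rfl, rfl⟩ := h
  have hX' : IsUnit Xᵀ.det := by rwa [det_transpose]
  refine ⟨Xᵀ⁻¹, d, ?_, ?_, ?_⟩
  · rw [det_nonsing_inv]; exact hX'.ringInverse
  all_goals
    rw [nonsing_inv_nonsing_inv _ hX']
    simp only [transpose_mul, diagonal_transpose, transpose_nonsing_inv, Matrix.mul_assoc]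

theorem IsPrincipalSqrt.conj (h : IsPrincipalSqrt A S) {Z : Matrix ι ι ℂ} (hZ : Z * Z = 1) :
    IsPrincipalSqrt (Z * A * Z) (Z * S * Z) := by
  obtain ⟨X, d, hX, rfl, rfl⟩ := h
  have hZi : Z⁻¹ = Z := inv_eq_right_inv hZ
  refine ⟨X * Z, d, ?_, ?_, ?_⟩
  · rw [det_mul]
    exact hX.mul ((isUnit_iff_isUnit_det Z).1 (IsUnit.of_mul_eq_one Z hZ))
  all_goals
    rw [Matrix.mul_inv_rev, hZi]
    simp only [Matrix.mul_assoc]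

/-- A real matrix without eigenvalues on the closed negative half-line has a real principal
square root. -/
theorem exists_real_of_isPrincipalSqrt {A : Matrix ι ι ℝ} {S : Matrix ι ι ℂ} {X : Matrix ι ι ℂ}
    {d : ι → ℂ} (hX : IsUnit X.det) (hd : ∀ i, d i ∈ Complex.slitPlane)
    (hA : A.map Complex.ofReal = X⁻¹ * diagonal d * X)
    (hS : IsPrincipalSqrt (A.map Complex.ofReal) S) :
    ∃ R : Matrix ι ι ℝ, S = R.map Complex.ofReal := by
  have hS' : S = X⁻¹ * diagonal (fun i => d i ^ (1 / 2 : ℂ)) * X :=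
    hS.unique ⟨X, d, hX, hA, rfl⟩
  have hinv : (X.map (starRingEnd ℂ))⁻¹ = X⁻¹.map (starRingEnd ℂ) := by
    refine inv_eq_right_inv ?_
    rw [← Matrix.map_mul, mul_nonsing_inv X hX]
    exact Matrix.map_one _ (map_zero _) (map_one _)
  -- Conjugating a diagonalization of a real matrix gives another one. Off the negative axis the
  -- principal root commutes with conjugation, so uniqueness will give that S equals its own
  -- conjugate.
  have hconj : IsPrincipalSqrt (A.map Complex.ofReal) (S.map (starRingEnd ℂ)) := by
    refine ⟨X.map (starRingEnd ℂ), fun i => starRingEnd ℂ (d i), ?_, ?_, ?_⟩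
    · have := hX.map (starRingEnd ℂ)
      rwa [RingHom.map_det] at this
    · have h := congrArg (fun M : Matrix ι ι ℂ => M.map (starRingEnd ℂ)) hA
      simp only [Matrix.map_mul, ← hinv] at h
      rw [diagonal_map (map_zero _)] at h
      rw [← h]
      ext i j
      simp
    · rw [hS', Matrix.map_mul, Matrix.map_mul, diagonal_map (map_zero _), hinv]
      congr 3
      ext i
      beta_reduce
      rw [Complex.conj_cpow _ _ (Complex.mem_slitPlane_iff_arg.1 (hd i)).1]
      simp [map_ofNat]
  have hreal := hS.unique hconj
  refine ⟨S.map Complex.re, ?_⟩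
  ext i j
  have hij := congrFun (congrFun hreal i) j
  simp only [map_apply] at hij ⊢
  exact (Complex.conj_eq_iff_re.1 hij.symm).symm

end PrincipalSqrt

/-! ### The spectral norm -/

section SpecNorm

variable {𝕜 ι : Type*} [RCLike 𝕜] [Fintype ι] [DecidableEq ι]

theorem specNorm_nonneg (A : Matrix ι ι 𝕜) : 0 ≤ specNorm A := norm_nonneg _

theorem specNorm_mul_le (A B : Matrix ι ι 𝕜) : specNorm (A * B) ≤ specNorm A * specNorm B := by
  unfold specNorm
  rw [map_mul]
  exact norm_mul_le _ _

theorem specNorm_smul (c : 𝕜) (A : Matrix ι ι 𝕜) : specNorm (c • A) = ‖c‖ * specNorm A := by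
  unfold specNorm
  rw [map_smul, norm_smul]

theorem specNorm_sum_le {κ : Type*} (s : Finset κ) (A : κ → Matrix ι ι 𝕜) :
    specNorm (∑ k ∈ s, A k) ≤ ∑ k ∈ s, specNorm (A k) := by
  unfold specNorm
  rw [map_sum]
  exact norm_sum_le _ _

theorem specNorm_conjTranspose (A : Matrix ι ι 𝕜) : specNorm Aᴴ = specNorm A := by
  unfold specNorm
  rw [← star_eq_conjTranspose, map_star, ContinuousLinearMap.star_eq_adjoint,
    LinearIsometryEquiv.norm_map]

theorem specNorm_pos {A : Matrix ι ι 𝕜} (hA : A ≠ 0) : 0 < specNorm A := by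
  unfold specNorm
  rw [norm_pos_iff]
  simpa using hA

theorem norm_mulVec_le (A : Matrix ι ι 𝕜) (v : ι → 𝕜) :
    ‖WithLp.toLp 2 (A *ᵥ v)‖ ≤ specNorm A * ‖WithLp.toLp 2 v‖ := by
  have := (Matrix.toEuclideanCLM (𝕜 := 𝕜) A).le_opNorm (WithLp.toLp 2 v)
  simpa [specNorm] using this

theorem specNorm_le {A : Matrix ι ι 𝕜} {c : ℝ} (hc : 0 ≤ c)
    (h : ∀ v : ι → 𝕜, ‖WithLp.toLp 2 (A *ᵥ v)‖ ≤ c * ‖WithLp.toLp 2 v‖) : specNorm A ≤ c := by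
  refine ContinuousLinearMap.opNorm_le_bound _ hc fun x => ?_
  have hx : Matrix.toEuclideanCLM (𝕜 := 𝕜) A x = WithLp.toLp 2 (A *ᵥ x.ofLp) := rfl
  rw [hx]
  exact h x.ofLp

theorem continuous_specNorm : Continuous (specNorm : Matrix ι ι 𝕜 → ℝ) := by
  have : Continuous (Matrix.toEuclideanCLM (𝕜 := 𝕜) (n := ι)) :=
    LinearMap.continuous_of_finiteDimensional
      ((Matrix.toEuclideanCLM (𝕜 := 𝕜) (n := ι)).toAlgEquiv.toLinearMap)
  exact continuous_norm.comp this

theorem specNorm_le_specNorm_ofReal (A : Matrix ι ι ℝ) :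
    specNorm A ≤ specNorm (A.map Complex.ofReal) := by
  refine specNorm_le (specNorm_nonneg _) fun v => ?_
  have hnorm : ∀ w : ι → ℝ, ‖WithLp.toLp 2 (fun i => (w i : ℂ))‖ = ‖WithLp.toLp 2 w‖ := by
    intro w
    simp [EuclideanSpace.norm_eq]
  have h := norm_mulVec_le (A.map Complex.ofReal) (fun i => (v i : ℂ))
  have hmv : A.map Complex.ofReal *ᵥ (fun i => (v i : ℂ)) = fun i => ((A *ᵥ v) i : ℂ) := by
    ext i
    simp [mulVec, dotProduct]
  rwa [hmv, hnorm, hnorm] at h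

end SpecNorm

/-! ### Spectrum and diagonalization of C_α -/

namespace WaveMinres

/-- The eigenvalue of `B₁ ⊗ L - 2 B₂ ⊗ I` belonging to the eigenvalues `z` of `B₂` and `l` of `L`. -/
def waveSymbol (n : ℕ) (l : ℝ) (z : ℂ) : ℂ := (if n = 1 then 1 else 1 + z ^ 2) * l - 2 * z

/-- For z = x + iy the imaginary part 2y(lx - 1) vanishes in two cases. If y = 0, the real part l(1
+ x²) - 2x exceeds (1 - x)². If lx = 1, then l times the real part is l²(1 - y²) - 1 > l²x² - 1 = 0,
because x² + y² < 1. -/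
theorem waveSymbol_mem_slitPlane {n : ℕ} {l : ℝ} (hl : 1 < l) {z : ℂ} (hz : ‖z‖ < 1)
    (hn : n ≠ 1) : waveSymbol n l z ∈ Complex.slitPlane := by
  have hz2 : z.re ^ 2 + z.im ^ 2 < 1 := by
    have h := Complex.sq_norm z
    rw [Complex.normSq_apply] at h
    nlinarith [norm_nonneg z]
  have hre : (waveSymbol n l z).re = l * (1 + z.re ^ 2 - z.im ^ 2) - 2 * z.re := by
    simp [waveSymbol, hn, pow_two]; ring
  have him : (waveSymbol n l z).im = 2 * (z.im * (l * z.re - 1)) := by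
    simp [waveSymbol, hn, pow_two]; ring
  rw [Complex.mem_slitPlane_iff, hre, him]
  by_contra! h
  obtain ⟨h1, h2⟩ := h
  rcases mul_eq_zero.1 (by linarith : z.im * (l * z.re - 1) = 0) with h0 | h0
  · rw [h0] at h1
    nlinarith [sq_nonneg (z.re - 1), sq_nonneg z.re]
  · have h3 : l * z.re = 1 := by linarith
    have h4 : l * (l * (1 + z.re ^ 2 - z.im ^ 2) - 2 * z.re) = l ^ 2 * (1 - z.im ^ 2) - 1 := by
      linear_combination (l * z.re + 1 - 2) * h3
    have h5 : l ^ 2 * z.re ^ 2 = 1 := by linear_combination (l * z.re + 1) * h3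
    nlinarith [pow_pos (zero_lt_one.trans hl) 2]

theorem waveSymbol_one_mem_slitPlane {l : ℝ} {z : ℂ} (hz : ‖z‖ < l / 2) :
    waveSymbol 1 l z ∈ Complex.slitPlane := by
  refine Complex.mem_slitPlane_iff.2 (Or.inl ?_)
  have := Complex.re_le_norm z
  simp [waveSymbol]
  linarith

/-- The n-th roots of α ≤ 1/2 lie in the closed disc of radius ρ. The margin up to R provides a
holomorphic square root on a neighbourhood of that disc. -/
theorem exists_lt_forall_waveSymbol_mem_slitPlane {n : ℕ} {l ρ : ℝ} (hl : 1 < l)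
    (hρ : ρ ^ n = 1 / 2) :
    ∃ R, ρ < R ∧ ∀ z : ℂ, ‖z‖ < R → waveSymbol n l z ∈ Complex.slitPlane := by
  by_cases hn : n = 1
  · subst hn
    exact ⟨l / 2, by linarith, fun z hz => waveSymbol_one_mem_slitPlane hz⟩
  · refine ⟨1, ?_, fun z hz => waveSymbol_mem_slitPlane hl hz hn⟩
    by_contra! h
    linarith [one_le_pow₀ h (n := n)]

theorem exists_injective_pow_eq {n : ℕ} (hn : n ≠ 0) {α : ℝ} (hα : 0 < α) :
    ∃ z : Fin n → ℂ, Function.Injective z ∧ ∀ k, z k ^ n = α := by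
  have hθ : ((α ^ (1 / n : ℝ) : ℝ) : ℂ) ^ n = α := by
    rw [one_div, ← Complex.ofReal_pow, Real.rpow_inv_natCast_pow hα.le hn]
  have hω := Complex.isPrimitiveRoot_exp n hn
  refine ⟨fun k => ((α ^ (1 / n : ℝ) : ℝ) : ℂ) * Complex.exp (2 * Real.pi * Complex.I / n) ^ (k : ℕ),
    fun i j hij => ?_, fun k => ?_⟩
  · have h0 : ((α ^ (1 / n : ℝ) : ℝ) : ℂ) ≠ 0 := by
      rw [Complex.ofReal_ne_zero]; positivity
    exact Fin.ext (hω.pow_inj i.2 j.2 (mul_left_cancel₀ h0 hij))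
  · rw [mul_pow, hθ, pow_right_comm, hω.pow_eq_one, one_pow, mul_one]

theorem sum_ite_val_eq {R : Type*} [Semiring R] {n : ℕ} (f : ℕ → R) (a : R) (p : Fin n → Prop)
    [DecidablePred p] {c : ℕ} (hc : c < n) (hp : ∀ i, p i ↔ i.val = c) :
    ∑ i : Fin n, f i.val * (if p i then a else 0) = f c * a := by
  rw [Finset.sum_eq_single ⟨c, hc⟩]
  · rw [if_pos ((hp _).2 rfl)]
  · intro i _ hi
    rw [if_neg, mul_zero]
    exact fun h => hi (Fin.ext ((hp i).1 h))
  · simp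

theorem sum_ite_eq_zero_of_forall_not {R : Type*} [Semiring R] {n : ℕ} (f : ℕ → R) (a : R)
    (p : Fin n → Prop) [DecidablePred p] (hp : ∀ i, ¬ p i) :
    ∑ i : Fin n, f i.val * (if p i then a else 0) = 0 :=
  Finset.sum_eq_zero fun i _ => by rw [if_neg (hp i), mul_zero]

/-- Each row (1, z, …, z^(n-1)) is a left eigenvector: the shift multiplies it by z, and zⁿ = α
closes the cycle at the wrapped-around entry. -/
theorem vandermonde_mul_timeB2 {n : ℕ} {α : ℝ} {z : Fin n → ℂ} (hz : ∀ k, z k ^ n = α) :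
    vandermonde z * (timeB2 n α).map Complex.ofReal = diagonal z * vandermonde z := by
  ext k j
  rw [diagonal_mul, mul_apply]
  simp only [vandermonde_apply, map_apply, timeB2, of_apply,
    Complex.ofReal_add, apply_ite Complex.ofReal, Complex.ofReal_one, Complex.ofReal_zero, mul_add,
    Finset.sum_add_distrib]
  have hj := j.2
  by_cases h : j.val + 1 < n
  · rw [sum_ite_val_eq (fun i => z k ^ i) 1 _ h fun i => Iff.rfl,
      sum_ite_eq_zero_of_forall_not (fun i => z k ^ i) _ _ fun i => by omega]
    ring
  · rw [sum_ite_val_eq (fun i => z k ^ i) (α : ℂ) (c := 0) _ (by omega) fun i => by omega,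
      sum_ite_eq_zero_of_forall_not (fun i => z k ^ i) _ _ fun i => by omega, ← hz k]
    rw [pow_zero, one_mul, zero_add, ← pow_succ']
    congr 1
    omega

/-- For n ≥ 2 the second subdiagonal with its wrapped entries acts as the square of the α-shift. For
n = 1 no index satisfies i + n = j + 2, so only the diagonal remains. -/
theorem vandermonde_mul_timeB1 {n : ℕ} {α : ℝ} {z : Fin n → ℂ} (hz : ∀ k, z k ^ n = α) :
    vandermonde z * (timeB1 n α).map Complex.ofReal
      = diagonal (fun k => if n = 1 then 1 else 1 + z k ^ 2) * vandermonde z := by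
  ext k j
  rw [diagonal_mul, mul_apply]
  simp only [vandermonde_apply, map_apply, timeB1, of_apply,
    Complex.ofReal_add, apply_ite Complex.ofReal, Complex.ofReal_one, Complex.ofReal_zero, mul_add,
    Finset.sum_add_distrib]
  have hj := j.2
  rw [sum_ite_val_eq (fun i => z k ^ i) 1 _ hj fun i => Iff.rfl]
  by_cases hn : n = 1
  · rw [sum_ite_eq_zero_of_forall_not (fun i => z k ^ i) _ _ fun i => by omega,
      sum_ite_eq_zero_of_forall_not (fun i => z k ^ i) _ _ fun i => by omega, if_pos hn]
    ring
  rw [if_neg hn]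
  by_cases h : j.val + 2 < n
  · rw [sum_ite_val_eq (fun i => z k ^ i) 1 _ h fun i => Iff.rfl,
      sum_ite_eq_zero_of_forall_not (fun i => z k ^ i) _ _ fun i => by omega]
    ring
  · rw [sum_ite_val_eq (fun i => z k ^ i) (α : ℂ) (c := j.val + 2 - n) _ (by omega)
        fun i => by omega,
      sum_ite_eq_zero_of_forall_not (fun i => z k ^ i) _ _ fun i => by omega, ← hz k, ← pow_add]
    rw [show j.val + 2 - n + n = j.val + 2 by omega]
    ring

variable {m : ℕ}

theorem map_kronecker_ofReal {ι κ : Type*} (A : Matrix ι ι ℝ) (B : Matrix κ κ ℝ) :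
    (A ⊗ₖ B).map Complex.ofReal = A.map Complex.ofReal ⊗ₖ B.map Complex.ofReal := by
  ext i j
  simp [kroneckerMap_apply]

theorem blockCℂ_eq (n : ℕ) (L : Matrix (Fin m) (Fin m) ℝ) (α : ℝ) :
    blockCℂ n L α = (timeB1 n α).map Complex.ofReal ⊗ₖ L.map Complex.ofReal
      + (timeB2 n α).map Complex.ofReal ⊗ₖ ((-2 : ℂ) • (1 : Matrix (Fin m) (Fin m) ℂ)) := by
  unfold blockCℂ blockC
  rw [Matrix.map_add _ Complex.ofReal_add, map_kronecker_ofReal, map_kronecker_ofReal]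
  congr 2
  ext i j
  by_cases h : i = j <;> simp [one_apply, h]

/-- `V ⊗ Q` diagonalizes `C_α` if `V` is the Vandermonde matrix of the `n`-th roots of `α` and `Q`
diagonalizes `L`. -/
theorem vandermonde_kronecker_mul_blockCℂ {n : ℕ} {α : ℝ} {z : Fin n → ℂ} (hz : ∀ k, z k ^ n = α)
    {L : Matrix (Fin m) (Fin m) ℝ} {Q : Matrix (Fin m) (Fin m) ℂ} {l : Fin m → ℝ}
    (hQ : Q * L.map Complex.ofReal = diagonal (fun i => (l i : ℂ)) * Q) :
    (vandermonde z ⊗ₖ Q) * blockCℂ n L α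
      = diagonal (fun p : Fin n × Fin m => waveSymbol n (l p.2) (z p.1)) * (vandermonde z ⊗ₖ Q) := by
  rw [blockCℂ_eq, Matrix.mul_add, ← mul_kronecker_mul, ← mul_kronecker_mul,
    vandermonde_mul_timeB1 hz, vandermonde_mul_timeB2 hz, hQ,
    show Q * ((-2 : ℂ) • (1 : Matrix (Fin m) (Fin m) ℂ)) = diagonal (fun _ => (-2 : ℂ)) * Q by
      rw [Matrix.mul_smul, Matrix.mul_one, ← smul_eq_diagonal_mul],
    mul_kronecker_mul, mul_kronecker_mul, diagonal_kronecker_diagonal, diagonal_kronecker_diagonal,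
    ← Matrix.add_mul, diagonal_add]
  congr 2
  ext p
  simp only [waveSymbol]
  ring

theorem isUnit_det_kronecker {n : ℕ} {V : Matrix (Fin n) (Fin n) ℂ} {Q : Matrix (Fin m) (Fin m) ℂ}
    (hV : IsUnit V.det) (hQ : IsUnit Q.det) : IsUnit (V ⊗ₖ Q).det := by
  rw [det_kronecker]
  exact (hV.pow _).mul (hQ.pow _)

theorem norm_le_of_pow_eq {n : ℕ} (hn : n ≠ 0) {α ρ : ℝ} (hρ : 0 ≤ ρ) (hρn : ρ ^ n = 1 / 2)
    (hα : α ∈ Set.Ioc (0 : ℝ) (1 / 2)) {z : ℂ} (hz : z ^ n = α) : ‖z‖ ≤ ρ := by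
  refine (pow_le_pow_iff_left₀ (norm_nonneg z) hρ hn).1 ?_
  rw [← norm_pow, hz, hρn, Complex.norm_real, Real.norm_of_nonneg hα.1.le]
  exact hα.2

theorem exists_pow_eq_half {n : ℕ} (hn : n ≠ 0) : ∃ ρ : ℝ, 0 < ρ ∧ ρ ^ n = 1 / 2 :=
  ⟨(1 / 2 : ℝ) ^ ((n : ℝ)⁻¹), by positivity, Real.rpow_inv_natCast_pow (by norm_num) hn⟩

/-- L is the identity plus the positive definite matrix (τ²/2)(-Δ_h), so its eigenvalues exceed 1.
-/
theorem exists_diagonalization_waveL {τ : ℝ} (hτ : 0 < τ) {Δh : Matrix (Fin m) (Fin m) ℝ}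
    (hΔ : (-Δh).PosDef) :
    ∃ (Q : Matrix (Fin m) (Fin m) ℂ) (l : Fin m → ℝ), IsUnit Q.det ∧ (∀ i, 1 < l i) ∧
      Q * (waveL τ Δh).map Complex.ofReal = diagonal (fun i => (l i : ℂ)) * Q := by
  have hD : ((τ ^ 2 / 2) • (-Δh)).PosDef := hΔ.smul (by positivity)
  set U := hD.1.eigenvectorUnitary with hU
  have hUU : star (U : Matrix (Fin m) (Fin m) ℝ) * (U : Matrix (Fin m) (Fin m) ℝ) = 1 :=
    Unitary.coe_star_mul_self U
  have hspec := hD.1.spectral_theorem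
  rw [Unitary.conjStarAlgAut_apply, ← hU] at hspec
  have hL : waveL τ Δh = 1 + (τ ^ 2 / 2) • (-Δh) := by
    rw [waveL, smul_neg, sub_eq_add_neg]
  have hreal : star (U : Matrix (Fin m) (Fin m) ℝ) * waveL τ Δh
      = diagonal (fun i => 1 + hD.1.eigenvalues i) * star (U : Matrix (Fin m) (Fin m) ℝ) := by
    rw [hL, Matrix.mul_add, Matrix.mul_one]
    conv_lhs => rw [hspec]
    rw [← Matrix.mul_assoc, ← Matrix.mul_assoc, hUU, Matrix.one_mul]
    rw [show diagonal (fun i => 1 + hD.1.eigenvalues i)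
        = 1 + diagonal (RCLike.ofReal ∘ hD.1.eigenvalues) by
      rw [← diagonal_one, diagonal_add]; rfl]
    rw [Matrix.add_mul, Matrix.one_mul]
  refine ⟨(star (U : Matrix (Fin m) (Fin m) ℝ)).map Complex.ofReal,
    fun i => 1 + hD.1.eigenvalues i, ?_, fun i => ?_, ?_⟩
  · have h1 : IsUnit (star (U : Matrix (Fin m) (Fin m) ℝ)).det :=
      (isUnit_iff_isUnit_det _).1 (IsUnit.of_mul_eq_one _ hUU)
    have h2 := h1.map Complex.ofRealHom
    rw [RingHom.map_det] at h2
    exact h2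
  · linarith [hD.eigenvalues_pos i]
  · have h := congrArg (fun M : Matrix (Fin m) (Fin m) ℝ => M.map Complex.ofRealHom) hreal
    simp only [Matrix.map_mul] at h
    rw [diagonal_map (map_zero _)] at h
    exact h

end WaveMinres

/-- On the `n`-th roots of `α ∈ [0, ρⁿ]` a function that is holomorphic on a neighbourhood of the
closed disc of radius `ρ` is a polynomial of degree less than `n`, with coefficients bounded
independently of `α`. -/
theorem exists_bounded_coeff_eval_roots {n : ℕ} (hn : n ≠ 0) {ρ R : ℝ} (hρ : 0 < ρ) (hR : ρ < R)
    {h : ℂ → ℂ} (hh : DifferentiableOn ℂ h (Metric.ball 0 R)) :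
    ∃ K : Fin n → ℝ, ∀ α : ℝ, 0 ≤ α → α ≤ ρ ^ n → ∃ a : Fin n → ℂ, (∀ r, ‖a r‖ ≤ K r) ∧
      ∀ z : ℂ, z ^ n = α → h z = ∑ r, a r * z ^ (r : ℕ) := by
  have : NeZero n := ⟨hn⟩
  obtain ⟨R', hR1, hR2⟩ := exists_between hR
  lift R' to NNReal using (hρ.trans hR1).le
  lift ρ to NNReal using hρ.le
  have hps := (hh.mono (Metric.closedBall_subset_ball hR2)).hasFPowerSeriesOnBall
    (NNReal.coe_pos.1 (hρ.trans hR1))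
  set p := cauchyPowerSeries h 0 R' with hp
  have hsum : Summable fun k => ‖p.coeff k‖ * (ρ : ℝ) ^ k := by
    have := p.summable_norm_mul_pow (r := ρ)
      (lt_of_lt_of_le (ENNReal.coe_lt_coe.2 (NNReal.coe_lt_coe.1 hR1)) hps.r_le)
    simpa [FormalMultilinearSeries.norm_apply_eq_norm_coef] using this
  -- The power series is grouped by residues: for k = qn + r one has z^k = α^q z^r, so the terms
  -- with fixed r sum to a coefficient that depends on α only.
  have hsum2 : ∀ r : Fin n, Summable fun q : ℕ => ‖p.coeff (q * n + r)‖ * ((ρ : ℝ) ^ n) ^ q := by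
    intro r
    have h1 : Summable fun q : ℕ => ‖p.coeff (q * n + r)‖ * (ρ : ℝ) ^ (q * n + r) :=
      hsum.comp_injective (i := fun q : ℕ => q * n + r) fun a b hab => by
        have : a * n = b * n := by simpa using hab
        exact Nat.eq_of_mul_eq_mul_right (Nat.pos_of_ne_zero hn) this
    refine (h1.mul_right (((ρ : ℝ) ^ (r : ℕ))⁻¹)).congr fun q => ?_
    have : (ρ : ℝ) ^ (r : ℕ) ≠ 0 := by positivity
    rw [pow_add, mul_comm q n, pow_mul]
    field_simp
  refine ⟨fun r => ∑' q : ℕ, ‖p.coeff (q * n + r)‖ * ((ρ : ℝ) ^ n) ^ q, fun α h0 h1 => ?_⟩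
  have hle : ∀ (r : Fin n) (q : ℕ), ‖p.coeff (q * n + r) * (α : ℂ) ^ q‖
      ≤ ‖p.coeff (q * n + r)‖ * ((ρ : ℝ) ^ n) ^ q := by
    intro r q
    rw [norm_mul, norm_pow, Complex.norm_real, Real.norm_of_nonneg h0]
    gcongr
  refine ⟨fun r => ∑' q : ℕ, p.coeff (q * n + r) * (α : ℂ) ^ q, fun r =>
    tsum_of_norm_bounded (hsum2 r).hasSum (hle r), fun z hz => ?_⟩
  have hzρ : ‖z‖ ≤ ρ := by
    refine (pow_le_pow_iff_left₀ (norm_nonneg z) hρ.le hn).1 ?_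
    rwa [← norm_pow, hz, Complex.norm_real, Real.norm_of_nonneg h0]
  have hs : HasSum (fun k => z ^ k * p.coeff k) (h z) := by
    have := hps.hasSum (y := z) (by
      simpa [Metric.eball_coe] using lt_of_le_of_lt hzρ hR1)
    simpa [FormalMultilinearSeries.apply_eq_pow_smul_coeff] using this
  rw [← (Nat.divModEquiv n).symm.hasSum_iff] at hs
  rw [← (Equiv.prodComm (Fin n) ℕ).hasSum_iff] at hs
  have hfib : ∀ r : Fin n, HasSum (fun q : ℕ => z ^ (q * n + r) * p.coeff (q * n + r))
      ((∑' q : ℕ, p.coeff (q * n + r) * (α : ℂ) ^ q) * z ^ (r : ℕ)) := by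
    intro r
    have h2 := (Summable.of_norm_bounded (hsum2 r) (hle r)).hasSum.mul_right (z ^ (r : ℕ))
    have h4 : (fun q : ℕ => z ^ (q * n + r) * p.coeff (q * n + r))
        = fun q : ℕ => p.coeff (q * n + r) * (α : ℂ) ^ q * z ^ (r : ℕ) := by
      funext q
      rw [← hz, pow_add, mul_comm q n, pow_mul]
      ring
    rw [h4]
    exact h2
  have h3 := hs.prod_fiberwise (f := fun x : Fin n × ℕ => z ^ (x.2 * n + x.1) * p.coeff (x.2 * n + x.1)) hfib
  exact h3.unique (hasSum_fintype _)

/-! ### Uniform bound for the inverse square root of C_α -/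

namespace WaveMinres

variable {m : ℕ}

theorem exists_diagonalization_blockCℂ {n : ℕ} (hn : n ≠ 0) {α : ℝ}
    (hα : α ∈ Set.Ioc (0 : ℝ) (1 / 2)) {L : Matrix (Fin m) (Fin m) ℝ}
    {Q : Matrix (Fin m) (Fin m) ℂ} {l : Fin m → ℝ} (hQu : IsUnit Q.det) (hl : ∀ i, 1 < l i)
    (hQ : Q * L.map Complex.ofReal = diagonal (fun i => (l i : ℂ)) * Q) :
    ∃ z : Fin n → ℂ, (∀ k, z k ^ n = α) ∧ IsUnit (vandermonde z ⊗ₖ Q).det ∧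
      (∀ p : Fin n × Fin m, waveSymbol n (l p.2) (z p.1) ∈ Complex.slitPlane) ∧
      blockCℂ n L α = (vandermonde z ⊗ₖ Q)⁻¹
        * diagonal (fun p : Fin n × Fin m => waveSymbol n (l p.2) (z p.1))
        * (vandermonde z ⊗ₖ Q) := by
  obtain ⟨z, hzi, hz⟩ := exists_injective_pow_eq hn hα.1
  obtain ⟨ρ, hρ, hρn⟩ := exists_pow_eq_half hn
  have hX : IsUnit (vandermonde z ⊗ₖ Q).det :=
    isUnit_det_kronecker (isUnit_iff_ne_zero.2 (det_vandermonde_ne_zero_iff.2 hzi)) hQu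
  refine ⟨z, hz, hX, fun p => ?_, ?_⟩
  · obtain ⟨R, hR, h⟩ := exists_lt_forall_waveSymbol_mem_slitPlane (hl p.2) hρn
    exact h _ ((norm_le_of_pow_eq hn hρ.le hρn hα (hz p.1)).trans_lt hR)
  · rw [Matrix.mul_assoc, ← vandermonde_kronecker_mul_blockCℂ hz hQ, ← Matrix.mul_assoc,
      nonsing_inv_mul _ hX, Matrix.one_mul]

/-- The factor `B₂ʳ ⊗ Q⁻¹ Eᵢᵢ Q`, diagonalized by `V ⊗ Q`. -/
def spectralTerm (n : ℕ) (Q : Matrix (Fin m) (Fin m) ℂ) (i : Fin m) (r : ℕ) (α : ℝ) :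
    Matrix (Fin n × Fin m) (Fin n × Fin m) ℂ :=
  (((timeB2 n α).map Complex.ofReal) ^ r) ⊗ₖ (Q⁻¹ * diagonal (Pi.single i 1) * Q)

/-- Continuity includes α = 0, where the Vandermonde nodes coalesce; compactness of [0, 1/2] then
bounds these factors. -/
theorem continuous_spectralTerm (n : ℕ) (Q : Matrix (Fin m) (Fin m) ℂ) (i : Fin m) (r : ℕ) :
    Continuous (spectralTerm n Q i r) := by
  have h2 : Continuous fun α : ℝ => (timeB2 n α).map Complex.ofReal := by
    refine continuous_matrix fun i j => ?_
    simp only [timeB2, map_apply, of_apply]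
    refine Complex.continuous_ofReal.comp (continuous_const.add ?_)
    split_ifs
    · exact continuous_id
    · exact continuous_const
  refine continuous_matrix fun p q => ?_
  simp only [spectralTerm, kroneckerMap_apply]
  exact ((h2.pow r).matrix_elem _ _).mul continuous_const

theorem vandermonde_kronecker_mul_spectralTerm {n : ℕ} {α : ℝ} {z : Fin n → ℂ}
    (hz : ∀ k, z k ^ n = α) {Q : Matrix (Fin m) (Fin m) ℂ} (hQ : IsUnit Q.det) (i : Fin m) (r : ℕ) :
    (vandermonde z ⊗ₖ Q) * spectralTerm n Q i r α
      = diagonal (fun p : Fin n × Fin m => z p.1 ^ r * (Pi.single i 1 : Fin m → ℂ) p.2)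
        * (vandermonde z ⊗ₖ Q) := by
  have hpow : vandermonde z * ((timeB2 n α).map Complex.ofReal) ^ r
      = diagonal (z ^ r) * vandermonde z := by
    induction r with
    | zero => simp
    | succ r ih =>
      rw [pow_succ, ← Matrix.mul_assoc, ih, Matrix.mul_assoc, vandermonde_mul_timeB2 hz,
        ← Matrix.mul_assoc, diagonal_mul_diagonal, pow_succ]
      rfl
  rw [spectralTerm, ← mul_kronecker_mul, hpow, ← Matrix.mul_assoc, ← Matrix.mul_assoc,
    mul_nonsing_inv _ hQ, Matrix.one_mul, mul_kronecker_mul, diagonal_kronecker_diagonal]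
  rfl

theorem inv_of_isPrincipalSqrt {ι : Type*} [Fintype ι] [DecidableEq ι] {A S X : Matrix ι ι ℂ}
    {d : ι → ℂ} (hX : IsUnit X.det) (hd : ∀ i, d i ≠ 0) (hA : A = X⁻¹ * diagonal d * X)
    (hS : IsPrincipalSqrt A S) :
    IsUnit S.det ∧ S⁻¹ = X⁻¹ * diagonal (fun i => (d i ^ (1 / 2 : ℂ))⁻¹) * X := by
  have hS' : S = X⁻¹ * diagonal (fun i => d i ^ (1 / 2 : ℂ)) * X := hS.unique ⟨X, d, hX, hA, rfl⟩
  have hmul : S * (X⁻¹ * diagonal (fun i => (d i ^ (1 / 2 : ℂ))⁻¹) * X) = 1 := by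
    calc _ = X⁻¹ * diagonal (fun i => d i ^ (1 / 2 : ℂ)) * (X * X⁻¹)
            * diagonal (fun i => (d i ^ (1 / 2 : ℂ))⁻¹) * X := by
          rw [hS']; simp only [Matrix.mul_assoc]
      _ = X⁻¹ * (diagonal (fun i => d i ^ (1 / 2 : ℂ))
            * diagonal (fun i => (d i ^ (1 / 2 : ℂ))⁻¹)) * X := by
          rw [mul_nonsing_inv _ hX]; simp only [Matrix.mul_assoc, Matrix.one_mul]
      _ = 1 := by
          rw [diagonal_mul_diagonal]
          have h1 : ∀ i, d i ^ (1 / 2 : ℂ) * (d i ^ (1 / 2 : ℂ))⁻¹ = 1 := fun i =>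
            mul_inv_cancel₀ fun h => hd i (Complex.cpow_eq_zero_iff _ _ |>.1 h).1
          simp only [h1, diagonal_one, Matrix.mul_one, nonsing_inv_mul _ hX]
  exact ⟨(isUnit_iff_isUnit_det _).1 (IsUnit.of_mul_eq_one _ hmul), inv_eq_right_inv hmul⟩

theorem isPrincipalSqrt_sqrtC {n : ℕ} (hn : n ≠ 0) {α : ℝ}
    (hα : α ∈ Set.Ioc (0 : ℝ) (1 / 2)) {L : Matrix (Fin m) (Fin m) ℝ}
    {Q : Matrix (Fin m) (Fin m) ℂ} {l : Fin m → ℝ} (hQu : IsUnit Q.det) (hl : ∀ i, 1 < l i)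
    (hQ : Q * L.map Complex.ofReal = diagonal (fun i => (l i : ℂ)) * Q) :
    IsPrincipalSqrt (blockCℂ n L α) (sqrtC n L α) := by
  obtain ⟨z, -, hX, -, hC⟩ := exists_diagonalization_blockCℂ hn hα hQu hl hQ
  exact IsPrincipalSqrt.isPrincipalSqrt_principalSqrt ⟨_, _, hX, hC, rfl⟩

/-- A bound through the conditioning of V ⊗ Q is not uniform as α → 0. On the n-th roots of α the
function `waveSymbol`^(-1/2) agrees with a polynomial whose coefficients are bounded uniformly, so
C_α^{-1/2} is a combination of the `spectralTerm`s, each bounded on [0, 1/2]. -/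
theorem exists_specNorm_inv_sqrtC_le {n : ℕ} (hn : n ≠ 0) {L : Matrix (Fin m) (Fin m) ℝ}
    {Q : Matrix (Fin m) (Fin m) ℂ} {l : Fin m → ℝ} (hQu : IsUnit Q.det) (hl : ∀ i, 1 < l i)
    (hQ : Q * L.map Complex.ofReal = diagonal (fun i => (l i : ℂ)) * Q) :
    ∃ M, ∀ α ∈ Set.Ioc (0 : ℝ) (1 / 2), specNorm (sqrtC n L α)⁻¹ ≤ M := by
  obtain ⟨ρ, hρ, hρn⟩ := exists_pow_eq_half hn
  have hcoef : ∀ i, ∃ K : Fin n → ℝ, ∀ α : ℝ, 0 ≤ α → α ≤ ρ ^ n → ∃ a : Fin n → ℂ,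
      (∀ r, ‖a r‖ ≤ K r) ∧ ∀ z : ℂ, z ^ n = α →
        (waveSymbol n (l i) z ^ (1 / 2 : ℂ))⁻¹ = ∑ r, a r * z ^ (r : ℕ) := by
    intro i
    obtain ⟨R, hR, h⟩ := exists_lt_forall_waveSymbol_mem_slitPlane (hl i) hρn
    refine exists_bounded_coeff_eval_roots hn hρ hR
      (h := fun z => (waveSymbol n (l i) z ^ (1 / 2 : ℂ))⁻¹) fun z hz => ?_
    have hmem := h z (by simpa using hz)
    have hdiff : DifferentiableAt ℂ (waveSymbol n (l i)) z := by
      unfold waveSymbol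
      split_ifs <;> fun_prop
    refine ((hdiff.cpow_const hmem).inv fun h0 => ?_).differentiableWithinAt
    exact Complex.slitPlane_ne_zero hmem (Complex.cpow_eq_zero_iff _ _ |>.1 h0).1
  choose K hK using hcoef
  have hbd : ∀ (i : Fin m) (r : Fin n), ∃ B, ∀ α ∈ Set.Icc (0 : ℝ) (1 / 2),
      specNorm (spectralTerm n Q i r α) ≤ B := by
    intro i r
    obtain ⟨B, hB⟩ := isCompact_Icc.bddAbove_image
      ((continuous_specNorm.comp (continuous_spectralTerm n Q i r)).continuousOn
        (s := Set.Icc (0 : ℝ) (1 / 2)))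
    exact ⟨B, fun α hα => hB ⟨α, hα, rfl⟩⟩
  choose B hB using hbd
  refine ⟨∑ i, ∑ r, K i r * B i r, fun α hα => ?_⟩
  obtain ⟨z, hz, hX, hmem, hC⟩ := exists_diagonalization_blockCℂ hn hα hQu hl hQ
  have hinv := (inv_of_isPrincipalSqrt hX (fun p => Complex.slitPlane_ne_zero (hmem p)) hC
    (isPrincipalSqrt_sqrtC hn hα hQu hl hQ)).2
  choose a ha1 ha2 using fun i => hK i α hα.1.le (hρn ▸ hα.2)
  have hsum : (sqrtC n L α)⁻¹ = ∑ i, ∑ r : Fin n, a i r • spectralTerm n Q i r α := by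
    -- Both sides are compared after multiplication by V ⊗ Q; at the eigenvalue indexed by p only
    -- the summand i = p.2 survives.
    have hmul : (vandermonde z ⊗ₖ Q) * ∑ i, ∑ r : Fin n, a i r • spectralTerm n Q i r α
        = diagonal (fun p : Fin n × Fin m => (waveSymbol n (l p.2) (z p.1) ^ (1 / 2 : ℂ))⁻¹)
          * (vandermonde z ⊗ₖ Q) := by
      simp only [Finset.mul_sum, Matrix.mul_smul, vandermonde_kronecker_mul_spectralTerm hz hQu]
      simp only [← Matrix.smul_mul, ← Finset.sum_mul]
      congr 1
      ext p q
      simp only [Matrix.sum_apply, Matrix.smul_apply, smul_eq_mul]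
      by_cases hpq : p = q
      · subst hpq
        simp only [diagonal_apply_eq]
        rw [ha2 p.2 (z p.1) (hz p.1), Finset.sum_eq_single p.2]
        · simp
        · intro i _ hi
          simp [hi.symm]
        · simp
      · simp [diagonal_apply_ne _ hpq]
    rw [hinv, Matrix.mul_assoc, ← hmul, ← Matrix.mul_assoc, nonsing_inv_mul _ hX, Matrix.one_mul]
  rw [hsum]
  refine (specNorm_sum_le _ _).trans (Finset.sum_le_sum fun i _ =>
    (specNorm_sum_le _ _).trans (Finset.sum_le_sum fun r _ => ?_))
  rw [specNorm_smul]
  exact mul_le_mul (ha1 i r) (hB i r α (Set.Ioc_subset_Icc_self hα)) (specNorm_nonneg _)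
    ((norm_nonneg _).trans (ha1 i r))

theorem bddAbove_c0Set {n : ℕ} (hn : n ≠ 0) {L : Matrix (Fin m) (Fin m) ℝ}
    {Q : Matrix (Fin m) (Fin m) ℂ} {l : Fin m → ℝ} (hQu : IsUnit Q.det) (hl : ∀ i, 1 < l i)
    (hQ : Q * L.map Complex.ofReal = diagonal (fun i => (l i : ℂ)) * Q) :
    BddAbove (c0Set n L) := by
  obtain ⟨M, hM⟩ := exists_specNorm_inv_sqrtC_le hn hQu hl hQ
  refine ⟨M ^ 2, ?_⟩
  rintro _ ⟨α, hα, rfl⟩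
  exact pow_le_pow_left₀ (specNorm_nonneg _) (hM α hα) 2

end WaveMinres

/-! ### Chebyshev residual polynomial -/

open Polynomial in
/-- The scaled Chebyshev polynomial that is small on `[-1-ε, -1+ε] ∪ [1-ε, 1+ε]`. -/
theorem exists_polynomial_abs_eval_le {ε : ℝ} (h0 : 0 < ε) (j : ℕ) :
    ∃ p : ℝ[X], p.natDegree ≤ 2 * j ∧ p.eval 0 = 1 ∧
      ∀ x : ℝ, 1 - ε ≤ |x| → |x| ≤ 1 + ε → ε ≤ 1 → |p.eval x| ≤ 2 * ε ^ j := by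
  -- The polynomial t = (1 + ε² - x²)/(2ε) sends x² in [(1-ε)², (1+ε)²] to [-1, 1]. Moreover t(0) =
  -- (ε + ε⁻¹)/2 = cosh(log ε), so T_j(t(0)) = (ε^j + ε^(-j))/2 ≥ 1/(2ε^j).
  set t : ℝ[X] := C (2 * ε)⁻¹ * (C (1 + ε ^ 2) - X ^ 2) with ht
  set a : ℝ := (Chebyshev.T ℝ j).eval (t.eval 0) with ha
  have hcosh : t.eval 0 = Real.cosh (Real.log ε) := by
    rw [Real.cosh_eq, Real.exp_neg, Real.exp_log h0, ht]
    simp only [eval_mul, eval_C, eval_sub, eval_pow, eval_X]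
    field_simp
    ring
  have hale : (2 * ε ^ j)⁻¹ ≤ a := by
    rw [ha, hcosh, Chebyshev.T_real_cosh, Real.cosh_eq, Real.exp_neg]
    have : Real.exp (((j : ℤ) : ℝ) * Real.log ε) = ε ^ j := by
      rw [Int.cast_natCast, mul_comm, ← Real.rpow_def_of_pos h0, Real.rpow_natCast]
    rw [this, mul_inv]
    have : 0 < ε ^ j := pow_pos h0 j
    linarith
  have hapos : 0 < a := lt_of_lt_of_le (by positivity) hale
  refine ⟨C a⁻¹ * (Chebyshev.T ℝ j).comp t, ?_, ?_, ?_⟩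
  · refine (natDegree_C_mul_le _ _).trans (natDegree_comp_le.trans ?_)
    rw [Chebyshev.natDegree_T, Int.natAbs_natCast, mul_comm]
    refine Nat.mul_le_mul_right j ?_
    rw [ht]
    compute_degree
  · rw [eval_mul, eval_C, eval_comp]
    exact inv_mul_cancel₀ hapos.ne'
  · intro x h1 h2 h3
    rw [eval_mul, eval_C, eval_comp, abs_mul, abs_of_pos (inv_pos.2 hapos)]
    have hx1 : (1 - ε) ^ 2 ≤ x ^ 2 := by
      rw [← sq_abs x]; exact pow_le_pow_left₀ (by linarith) h1 2
    have hx2 : x ^ 2 ≤ (1 + ε) ^ 2 := by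
      rw [← sq_abs x]; exact pow_le_pow_left₀ (abs_nonneg x) h2 2
    have hT : |(Chebyshev.T ℝ j).eval (t.eval x)| ≤ 1 := by
      refine Chebyshev.abs_eval_T_real_le_one _ ?_
      rw [ht]
      simp only [eval_mul, eval_C, eval_sub, eval_pow, eval_X]
      rw [abs_mul, abs_of_pos (by positivity : 0 < (2 * ε)⁻¹), inv_mul_le_one₀ (by positivity),
        abs_le]
      constructor <;> linarith
    calc a⁻¹ * |(Chebyshev.T ℝ j).eval (t.eval x)| ≤ a⁻¹ * 1 := by gcongr
      _ ≤ 2 * ε ^ j := by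
        rw [mul_one]
        exact (inv_le_comm₀ (by positivity) hapos).1 hale

/-! ### Linear least squares -/

section LeastSquares

variable {V E : Type*} [AddCommGroup V] [Module ℝ V] [NormedAddCommGroup E]
  [InnerProductSpace ℝ E] [FiniteDimensional ℝ V]

/-- A linear least squares problem with an injective map has exactly one solution. -/
theorem existsUnique_mem_forall_norm_add_le (K : Submodule ℝ V) {g : V →ₗ[ℝ] E}
    (hg : Function.Injective g) (b : E) :
    ∃! w, w ∈ K ∧ ∀ v ∈ K, ‖b + g w‖ ≤ ‖b + g v‖ := by
  set H := K.map g with hH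
  set y := H.starProjection b with hy
  have hyH : y ∈ H := H.starProjection_apply_mem b
  -- Pythagoras: b - y is orthogonal to H, which contains y + g v.
  have key : ∀ v ∈ K, ‖b + g v‖ * ‖b + g v‖ = ‖b - y‖ * ‖b - y‖ + ‖y + g v‖ * ‖y + g v‖ := by
    intro v hv
    rw [← norm_add_sq_eq_norm_sq_add_norm_sq_real (Submodule.inner_left_of_mem_orthogonal
      (H.add_mem hyH (Submodule.mem_map_of_mem hv)) (H.sub_starProjection_mem_orthogonal b))]
    rw [show b - y + (y + g v) = b + g v by abel]
  obtain ⟨w₀, hw₀, hgw₀⟩ := hyH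
  have hneg : y + g (-w₀) = 0 := by rw [map_neg, hgw₀, add_neg_cancel]
  have hmin := key (-w₀) (K.neg_mem hw₀)
  rw [hneg, norm_zero, mul_zero, add_zero] at hmin
  refine ⟨-w₀, ⟨K.neg_mem hw₀, fun v hv => ?_⟩, fun w hw => hg ?_⟩
  · have := key v hv
    nlinarith [norm_nonneg (b + g (-w₀)), norm_nonneg (b + g v), norm_nonneg (y + g v)]
  · have h1 := hw.2 _ (K.neg_mem hw₀)
    have h2 := key w hw.1
    have h3 : ‖y + g w‖ = 0 := by
      nlinarith [norm_nonneg (b + g (-w₀)), norm_nonneg (b + g w), norm_nonneg (y + g w)]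
    rw [norm_eq_zero, ← hneg] at h3
    exact add_left_cancel h3

end LeastSquares

/-! ### MINRES: well-posedness and convergence -/

section Minres

variable {ι : Type*} [Fintype ι] [DecidableEq ι]

theorem aeval_mulVec_mem_krylov (G : Matrix ι ι ℝ) (r : ι → ℝ) {k : ℕ} {q : Polynomial ℝ}
    (hq : q.natDegree < k) : Polynomial.aeval G q *ᵥ r ∈ krylov G r k := by
  rw [Polynomial.aeval_eq_sum_range' hq, Matrix.sum_mulVec]
  refine Submodule.sum_mem _ fun i hi => ?_
  rw [Matrix.smul_mulVec]
  exact Submodule.smul_mem _ _ (Submodule.subset_span ⟨⟨i, Finset.mem_range.1 hi⟩, rfl⟩)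

theorem semiconjBy_aeval {R G Q : Matrix ι ι ℝ} (h : SemiconjBy R G Q) (p : Polynomial ℝ) :
    SemiconjBy R (Polynomial.aeval G p) (Polynomial.aeval Q p) := by
  rw [SemiconjBy, Polynomial.aeval_eq_sum_range, Polynomial.aeval_eq_sum_range, Finset.mul_sum,
    Finset.sum_mul]
  refine Finset.sum_congr rfl fun i _ => ?_
  rw [Matrix.mul_smul, Matrix.smul_mul, (h.pow_right i).eq]

/-- In the orthonormal eigenbasis of Q, p(Q) multiplies the i-th coordinate by p(λᵢ); Parseval
concludes. -/
theorem Matrix.IsHermitian.norm_aeval_mulVec_le {Q : Matrix ι ι ℝ} (hQ : Q.IsHermitian)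
    {p : Polynomial ℝ} {c : ℝ} (hc : ∀ i, |p.eval (hQ.eigenvalues i)| ≤ c) (v : ι → ℝ) :
    ‖WithLp.toLp 2 (Polynomial.aeval Q p *ᵥ v)‖ ≤ c * ‖WithLp.toLp 2 v‖ := by
  have hpow : ∀ (k : ℕ) (i : ι) (w : ι → ℝ), (hQ.eigenvectorBasis i).ofLp ⬝ᵥ (Q ^ k *ᵥ w)
      = hQ.eigenvalues i ^ k * ((hQ.eigenvectorBasis i).ofLp ⬝ᵥ w) := by
    intro k i w
    induction k with
    | zero => simp
    | succ k ih =>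
      rw [pow_succ', ← mulVec_mulVec, dotProduct_mulVec, ← mulVec_transpose,
        ← conjTranspose_eq_transpose_of_trivial, hQ.eq, hQ.mulVec_eigenvectorBasis, smul_dotProduct,
        ih, smul_eq_mul]
      ring
  have hp : ∀ i, inner ℝ (hQ.eigenvectorBasis i) (WithLp.toLp 2 (Polynomial.aeval Q p *ᵥ v))
      = p.eval (hQ.eigenvalues i) * inner ℝ (hQ.eigenvectorBasis i) (WithLp.toLp 2 v) := by
    intro i
    have hin : ∀ w : ι → ℝ, inner ℝ (hQ.eigenvectorBasis i) (WithLp.toLp 2 w)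
        = (hQ.eigenvectorBasis i).ofLp ⬝ᵥ w := by
      intro w
      rw [EuclideanSpace.inner_eq_star_dotProduct, dotProduct_comm]
      simp
    rw [hin, hin, Polynomial.aeval_eq_sum_range, Matrix.sum_mulVec, dotProduct_sum,
      Polynomial.eval_eq_sum_range, Finset.sum_mul]
    refine Finset.sum_congr rfl fun k _ => ?_
    rw [Matrix.smul_mulVec, dotProduct_smul, hpow, smul_eq_mul]
    ring
  -- For empty `ι` the hypothesis does not force c ≥ 0, but both norms vanish.
  rcases isEmpty_or_nonempty ι with hι | ⟨⟨i₀⟩⟩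
  · have hz : ∀ w : ι → ℝ, ‖WithLp.toLp 2 w‖ = 0 := fun w => by
      rw [Subsingleton.elim w 0]; simp
    rw [hz, hz, mul_zero]
  have hc0 : 0 ≤ c := (abs_nonneg _).trans (hc i₀)
  refine le_of_sq_le_sq ?_ (by positivity)
  rw [mul_pow, ← hQ.eigenvectorBasis.sum_sq_norm_inner_right,
    ← hQ.eigenvectorBasis.sum_sq_norm_inner_right, Finset.mul_sum]
  refine Finset.sum_le_sum fun i _ => ?_
  rw [hp, norm_mul, mul_pow]
  gcongr
  exact hc i

theorem Matrix.IsHermitian.abs_eigenvalues_eq_norm {Q : Matrix ι ι ℝ} (hQ : Q.IsHermitian) (i : ι) :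
    |hQ.eigenvalues i| = ‖WithLp.toLp 2 (Q *ᵥ (hQ.eigenvectorBasis i).ofLp)‖ := by
  rw [hQ.mulVec_eigenvectorBasis, WithLp.toLp_smul, norm_smul]
  simp

theorem energyNorm_transpose_mul_self {κ : Type*} [Fintype κ] (R : Matrix κ κ ℝ) (v : κ → ℝ) :
    energyNorm (Rᵀ * R) v = ‖WithLp.toLp 2 (R *ᵥ v)‖ := by
  rw [energyNorm, ← mulVec_mulVec, dotProduct_mulVec, vecMul_transpose, EuclideanSpace.norm_eq]
  congr 1
  simp [dotProduct, pow_two]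

theorem precResidual_eq_add (P A : Matrix ι ι ℝ) (b u₀ u : ι → ℝ) :
    precResidual P A b u = precResidual P A b u₀ + (P⁻¹ * A) *ᵥ (u - u₀) := by
  simp only [precResidual, mulVec_sub, ← mulVec_mulVec]
  abel

variable {R A Q : Matrix ι ι ℝ} {ε : ℝ}

/-- The map R carries the preconditioned matrix to Q and the P-norm to the Euclidean norm, so the
analysis takes place for Q. -/
theorem semiconjBy_precond (hR : IsUnit R.det) (hQ : Q = R⁻¹ᵀ * A * R⁻¹) :
    SemiconjBy R ((Rᵀ * R)⁻¹ * A) Q := by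
  rw [SemiconjBy, hQ, Matrix.mul_inv_rev, Matrix.mul_assoc _ R⁻¹ R, nonsing_inv_mul _ hR,
    Matrix.mul_one, ← Matrix.mul_assoc, ← Matrix.mul_assoc, mul_nonsing_inv _ hR, Matrix.one_mul,
    transpose_nonsing_inv]

/-- The lower bound with ε < 1 makes Q, hence R G = Q R, injective. Minimizing the residual over the
Krylov space is then a least squares problem with a unique solution. -/
theorem existsUnique_isMinresIterate (hR : IsUnit R.det) (hQ : Q = R⁻¹ᵀ * A * R⁻¹) (hε : ε < 1)
    (hlow : ∀ v : ι → ℝ, (1 - ε) * ‖WithLp.toLp 2 v‖ ≤ ‖WithLp.toLp 2 (Q *ᵥ v)‖)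
    (b u₀ : ι → ℝ) (k : ℕ) : ∃! u, IsMinresIterate (Rᵀ * R) A b u₀ k u := by
  set G := (Rᵀ * R)⁻¹ * A with hG
  set r := precResidual (Rᵀ * R) A b u₀ with hr
  let g : (ι → ℝ) →ₗ[ℝ] EuclideanSpace ℝ ι :=
    (WithLp.linearEquiv 2 ℝ (ι → ℝ)).symm.toLinearMap ∘ₗ (R * G).mulVecLin
  have hg : ∀ w, g w = WithLp.toLp 2 ((R * G) *ᵥ w) := fun w => rfl
  have hginj : Function.Injective g := by
    refine (injective_iff_map_eq_zero g).2 fun w hw => ?_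
    rw [hg, (semiconjBy_precond hR hQ).eq, ← mulVec_mulVec] at hw
    have h1 := hlow (R *ᵥ w)
    rw [hw, norm_zero] at h1
    have h2 : ‖WithLp.toLp 2 (R *ᵥ w)‖ = 0 := by
      nlinarith [norm_nonneg (WithLp.toLp 2 (R *ᵥ w))]
    have h3 : R *ᵥ w = 0 := by simpa using h2
    rw [← one_mulVec w, ← nonsing_inv_mul R hR, ← mulVec_mulVec, h3, mulVec_zero]
  have henergy : ∀ u, energyNorm (Rᵀ * R) (precResidual (Rᵀ * R) A b u)
      = ‖WithLp.toLp 2 (R *ᵥ r) + g (u - u₀)‖ := by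
    intro u
    rw [energyNorm_transpose_mul_self, precResidual_eq_add _ _ b u₀ u, mulVec_add, mulVec_mulVec,
      WithLp.toLp_add]
    rfl
  obtain ⟨w, ⟨hwK, hwmin⟩, huniq⟩ :=
    existsUnique_mem_forall_norm_add_le (krylov G r k) hginj (WithLp.toLp 2 (R *ᵥ r))
  refine ⟨u₀ + w, ⟨?_, fun v hv => ?_⟩, fun u hu => ?_⟩
  · rwa [add_sub_cancel_left]
  · rw [henergy, henergy, add_sub_cancel_left]
    exact hwmin _ hv
  · rw [← huniq (u - u₀) ⟨hu.1, fun v hv => ?_⟩, add_sub_cancel]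
    have := hu.2 (u₀ + v) (by rwa [add_sub_cancel_left])
    rwa [henergy, henergy, add_sub_cancel_left] at this

/-- The iterate is compared with u₀ + q(G) r, where the Chebyshev polynomial is p = 1 + X q. The
residual of that candidate is p(G) r, and R turns it into p(Q) R r, controlled by the values of p at
the eigenvalues of Q. -/
theorem IsMinresIterate.energyNorm_precResidual_le (hR : IsUnit R.det) (hQ : Q = R⁻¹ᵀ * A * R⁻¹)
    (hQs : Q.IsHermitian) (hε0 : 0 < ε) (hε : ε ≤ 1)
    (hlow : ∀ v : ι → ℝ, (1 - ε) * ‖WithLp.toLp 2 v‖ ≤ ‖WithLp.toLp 2 (Q *ᵥ v)‖)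
    (hup : ∀ v : ι → ℝ, ‖WithLp.toLp 2 (Q *ᵥ v)‖ ≤ (1 + ε) * ‖WithLp.toLp 2 v‖)
    {b u₀ u : ι → ℝ} {k : ℕ} (hk : 1 ≤ k) (hu : IsMinresIterate (Rᵀ * R) A b u₀ k u) :
    energyNorm (Rᵀ * R) (precResidual (Rᵀ * R) A b u)
      ≤ 2 * ε ^ (k / 2) * energyNorm (Rᵀ * R) (precResidual (Rᵀ * R) A b u₀) := by
  set G := (Rᵀ * R)⁻¹ * A with hG
  set r := precResidual (Rᵀ * R) A b u₀ with hr
  obtain ⟨p, hdeg, hp0, hp⟩ := exists_polynomial_abs_eval_le hε0 (k / 2)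
  -- Here deg q ≤ 2⌊k/2⌋ - 1 < k. The truncated subtraction is harmless because k ≥ 1.
  have hmem : Polynomial.aeval G p.divX *ᵥ r ∈ krylov G r k := by
    refine aeval_mulVec_mem_krylov G r ?_
    rw [Polynomial.natDegree_divX_eq_natDegree_tsub_one]
    omega
  have hres : precResidual (Rᵀ * R) A b (u₀ + Polynomial.aeval G p.divX *ᵥ r)
      = Polynomial.aeval G p *ᵥ r := by
    rw [precResidual_eq_add _ _ b u₀, add_sub_cancel_left, mulVec_mulVec, ← hG, ← hr]
    conv_rhs => rw [← Polynomial.X_mul_divX_add p, Polynomial.coeff_zero_eq_eval_zero, hp0]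
    simp [add_mulVec, add_comm]
  refine (hu.2 _ (by rwa [add_sub_cancel_left])).trans ?_
  rw [hres, energyNorm_transpose_mul_self, energyNorm_transpose_mul_self, mulVec_mulVec,
    (semiconjBy_aeval (semiconjBy_precond hR hQ) p).eq, ← mulVec_mulVec]
  refine hQs.norm_aeval_mulVec_le (fun i => hp _ ?_ ?_ hε) _
  · rw [hQs.abs_eigenvalues_eq_norm]
    simpa using hlow (hQs.eigenvectorBasis i).ofLp
  · rw [hQs.abs_eigenvalues_eq_norm]
    simpa using hup (hQs.eigenvectorBasis i).ofLp

end Minres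

/-! ### Persymmetry, the wrap-around term and the preconditioned matrix -/

namespace WaveMinres

variable {m : ℕ}

theorem antiId_mul_apply {n : ℕ} (M : Matrix (Fin n) (Fin n) ℝ) (i j : Fin n) :
    (antiId n * M) i j = M i.rev j := by
  have hi := i.2
  rw [mul_apply, Finset.sum_eq_single i.rev]
  · rw [antiId, of_apply, if_pos (by rw [Fin.val_rev]; omega), one_mul]
  · intro k _ hk
    rw [antiId, of_apply, if_neg, zero_mul]
    exact fun h => hk (Fin.ext (by rw [Fin.val_rev]; omega))
  · simp

theorem antiId_transpose (n : ℕ) : (antiId n)ᵀ = antiId n := by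
  ext i j
  simp only [antiId, transpose_apply, of_apply]
  congr 1
  rw [add_comm i.val]

theorem mul_antiId_apply {n : ℕ} (M : Matrix (Fin n) (Fin n) ℝ) (i j : Fin n) :
    (M * antiId n) i j = M i j.rev := by
  rw [← transpose_apply (M * antiId n), transpose_mul, antiId_transpose, antiId_mul_apply,
    transpose_apply]

theorem antiId_mul_self (n : ℕ) : antiId n * antiId n = 1 := by
  ext i j
  have := i.2
  have := j.2
  rw [antiId_mul_apply, antiId, of_apply, one_apply]
  congr 1
  rw [Fin.val_rev, Fin.ext_iff, eq_iff_iff]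
  omega

/-- Persymmetry: the entries depend on i - j only, and reversing both indices replaces i - j by j -
i. -/
theorem antiId_conj_timeB1 (n : ℕ) (α : ℝ) :
    antiId n * timeB1 n α * antiId n = (timeB1 n α)ᵀ := by
  ext i j
  have := i.2
  have := j.2
  rw [mul_antiId_apply, antiId_mul_apply, transpose_apply]
  simp only [timeB1, of_apply, Fin.val_rev]
  congr 1
  · congr 1
    all_goals
      congr 1
      rw [eq_iff_iff]
      omega
  · congr 1
    rw [eq_iff_iff]
    omega

theorem antiId_conj_timeB2 (n : ℕ) (α : ℝ) :
    antiId n * timeB2 n α * antiId n = (timeB2 n α)ᵀ := by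
  ext i j
  have := i.2
  have := j.2
  rw [mul_antiId_apply, antiId_mul_apply, transpose_apply]
  simp only [timeB2, of_apply, Fin.val_rev]
  congr 1
  all_goals
    congr 1
    rw [eq_iff_iff]
    omega

theorem blockY_mul_self (m n : ℕ) : blockY m n * blockY m n = 1 := by
  rw [blockY, ← mul_kronecker_mul, antiId_mul_self, Matrix.one_mul, one_kronecker_one]

theorem blockY_transpose (m n : ℕ) : (blockY m n)ᵀ = blockY m n := by
  rw [blockY, ← kroneckerMap_transpose, antiId_transpose, transpose_one]

theorem blockY_conj_blockC (n : ℕ) {L : Matrix (Fin m) (Fin m) ℝ} (hL : Lᵀ = L) (α : ℝ) :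
    blockY m n * blockC n L α * blockY m n = (blockC n L α)ᵀ := by
  rw [blockY, blockC, Matrix.mul_add, Matrix.add_mul, ← mul_kronecker_mul, ← mul_kronecker_mul,
    ← mul_kronecker_mul, ← mul_kronecker_mul, antiId_conj_timeB1, antiId_conj_timeB2, transpose_add,
    ← kroneckerMap_transpose, ← kroneckerMap_transpose, hL]
  simp

/-- The wrap-around part of `C_α`: `C_α = T + α W`. -/
def wrapW (n : ℕ) (L : Matrix (Fin m) (Fin m) ℝ) : Matrix (Fin n × Fin m) (Fin n × Fin m) ℝ :=
  (Matrix.of fun i j : Fin n => if i.val + n = j.val + 2 then (1 : ℝ) else 0) ⊗ₖ L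
    + (Matrix.of fun i j : Fin n => if i.val + n = j.val + 1 then (1 : ℝ) else 0)
      ⊗ₖ ((-2 : ℝ) • (1 : Matrix (Fin m) (Fin m) ℝ))

theorem blockC_eq_blockT_add (n : ℕ) (L : Matrix (Fin m) (Fin m) ℝ) (α : ℝ) :
    blockC n L α = blockT n L + α • wrapW n L := by
  ext p q
  simp only [blockT, blockC, wrapW, timeB1, timeB2, Matrix.add_apply, Matrix.smul_apply,
    kroneckerMap_apply, of_apply, smul_eq_mul]
  split_ifs <;> ring

theorem kronecker_mulVec_apply {n : ℕ} (A : Matrix (Fin n) (Fin n) ℝ) (B : Matrix (Fin m) (Fin m) ℝ)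
    (v : Fin n × Fin m → ℝ) (i : Fin n) :
    (fun s => ((A ⊗ₖ B) *ᵥ v) (i, s)) = ∑ j, A i j • (B *ᵥ fun t => v (j, t)) := by
  ext s
  simp only [mulVec, dotProduct, Fintype.sum_prod_type, kroneckerMap_apply, Finset.sum_apply,
    Pi.smul_apply, smul_eq_mul, Finset.mul_sum, mul_assoc]

theorem norm_sq_eq_sum_blocks {n : ℕ} (v : Fin n × Fin m → ℝ) :
    ‖WithLp.toLp 2 v‖ ^ 2 = ∑ i, ‖WithLp.toLp 2 fun s => v (i, s)‖ ^ 2 := by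
  simp only [EuclideanSpace.norm_sq_eq, Fintype.sum_prod_type]

/-- The constant s + 1, with s = √(l² + 1), is the spectral norm of the matrix with rows (l, 2) and
(0, l). The difference of the two sides is twice a quadratic form which, multiplied by s + 1,
becomes the square of (s+1)x - ly. -/
theorem sq_add_sq_le_of_norm {l x y : ℝ} :
    (l * x + 2 * y) ^ 2 + (l * y) ^ 2 ≤ (Real.sqrt (l ^ 2 + 1) + 1) ^ 2 * (x ^ 2 + y ^ 2) := by
  have hs : Real.sqrt (l ^ 2 + 1) ^ 2 = l ^ 2 + 1 := Real.sq_sqrt (by positivity)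
  set s := Real.sqrt (l ^ 2 + 1) with hsdef
  have hs0 : 0 ≤ s := Real.sqrt_nonneg _
  have key : 0 ≤ (s + 1) * ((s + 1) * x ^ 2 + (s - 1) * y ^ 2 - 2 * l * x * y) := by
    have : (s + 1) * ((s + 1) * x ^ 2 + (s - 1) * y ^ 2 - 2 * l * x * y)
        = ((s + 1) * x - l * y) ^ 2 := by linear_combination y ^ 2 * hs
    rw [this]
    positivity
  have h2 := nonneg_of_mul_nonneg_right key (by linarith)
  have : (s + 1) ^ 2 * (x ^ 2 + y ^ 2) - ((l * x + 2 * y) ^ 2 + (l * y) ^ 2)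
      = 2 * ((s + 1) * x ^ 2 + (s - 1) * y ^ 2 - 2 * l * x * y) := by
    linear_combination (x ^ 2 + y ^ 2) * hs
  linarith

theorem wrapW_mulVec {n : ℕ} (L : Matrix (Fin m) (Fin m) ℝ) (v : Fin n × Fin m → ℝ) (i : Fin n) :
    (fun s => (wrapW n L *ᵥ v) (i, s))
      = (∑ j : Fin n, (if i.val + n = j.val + 2 then (1 : ℝ) else 0) • (L *ᵥ fun t => v (j, t)))
        + ∑ j : Fin n, (if i.val + n = j.val + 1 then (1 : ℝ) else 0) • ((-2 : ℝ) • fun t => v (j, t)) := by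
  have h1 := kronecker_mulVec_apply
    (Matrix.of fun i j : Fin n => if i.val + n = j.val + 2 then (1 : ℝ) else 0) L v i
  have h2 := kronecker_mulVec_apply
    (Matrix.of fun i j : Fin n => if i.val + n = j.val + 1 then (1 : ℝ) else 0)
    ((-2 : ℝ) • (1 : Matrix (Fin m) (Fin m) ℝ)) v i
  simp only [of_apply, Matrix.smul_mulVec, one_mulVec] at h1 h2
  rw [← h1, ← h2, wrapW, add_mulVec]
  rfl

theorem sum_ite_smul_eq {n : ℕ} {E : Type*} [AddCommGroup E] [Module ℝ E] {p : Fin n → Prop}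
    [DecidablePred p] {c : Fin n} (hp : ∀ j, p j ↔ j = c) (g : Fin n → E) :
    ∑ j, (if p j then (1 : ℝ) else 0) • g j = g c := by
  simp [hp]

theorem sum_ite_smul_eq_zero {n : ℕ} {E : Type*} [AddCommGroup E] [Module ℝ E] {p : Fin n → Prop}
    [DecidablePred p] (hp : ∀ j, ¬ p j) (g : Fin n → E) :
    ∑ j, (if p j then (1 : ℝ) else 0) • g j = 0 := by
  simp [hp]

/-- For n ≥ 2 the only nonzero part of W is the 2 × 2 block with rows (L, -2I) and (0, L), in the
first two block rows and last two block columns. This reduces the bound to the scalar inequality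
`sq_add_sq_le_of_norm`. -/
theorem specNorm_wrapW_le {n : ℕ} (hn : n ≠ 0) (L : Matrix (Fin m) (Fin m) ℝ) :
    specNorm (wrapW n L) ≤ Real.sqrt (specNorm L ^ 2 + 1) + 1 := by
  refine specNorm_le (by positivity) fun v => ?_
  refine le_of_sq_le_sq ?_ (by positivity)
  rw [mul_pow, norm_sq_eq_sum_blocks, norm_sq_eq_sum_blocks]
  match n, hn with
  -- Here W = -2I, and the constant is at least 2.
  | 1, _ =>
    have hs : (1 : ℝ) ≤ Real.sqrt (specNorm L ^ 2 + 1) :=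
      Real.one_le_sqrt.2 (by nlinarith [sq_nonneg (specNorm L)])
    simp only [wrapW_mulVec, Fin.sum_univ_one, Fin.val_zero]
    norm_num [norm_smul, mul_pow]
    gcongr
    nlinarith
  | N + 2, _ =>
    set a : Fin m → ℝ := fun t => v ((Fin.last N).castSucc, t) with ha
    set b : Fin m → ℝ := fun t => v (Fin.last (N + 1), t) with hb
    have hval : ∀ j : Fin (N + 2), (j = (Fin.last N).castSucc ↔ j.val = N) ∧
        (j = Fin.last (N + 1) ↔ j.val = N + 1) := fun j => by simp [Fin.ext_iff]
    have hW0 : (fun t => (wrapW (N + 2) L *ᵥ v) (0, t)) = L *ᵥ a + (-2 : ℝ) • b :=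
      (wrapW_mulVec L v 0).trans (congrArg₂ (· + ·)
        (sum_ite_smul_eq (c := (Fin.last N).castSucc)
          (fun j => by rw [(hval j).1, Fin.val_zero]; omega) _)
        (sum_ite_smul_eq (c := Fin.last (N + 1))
          (fun j => by rw [(hval j).2, Fin.val_zero]; omega) _))
    have hW1 : (fun t => (wrapW (N + 2) L *ᵥ v) (Fin.succ 0, t)) = L *ᵥ b := by
      refine (wrapW_mulVec L v _).trans ((congrArg₂ (· + ·)
        (sum_ite_smul_eq (c := Fin.last (N + 1))
          (fun j => by rw [(hval j).2, Fin.val_succ, Fin.val_zero]; omega) _)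
        (sum_ite_smul_eq_zero (fun j => by have := j.2; rw [Fin.val_succ]; omega) _)).trans
          (add_zero _))
    have hW2 : ∀ i : Fin N, (fun t => (wrapW (N + 2) L *ᵥ v) (i.succ.succ, t)) = 0 := fun i =>
      (wrapW_mulVec L v _).trans ((congrArg₂ (· + ·)
        (sum_ite_smul_eq_zero
          (fun j => by have := j.2; rw [Fin.val_succ, Fin.val_succ]; omega) _)
        (sum_ite_smul_eq_zero
          (fun j => by have := j.2; rw [Fin.val_succ, Fin.val_succ]; omega) _)).trans
          (add_zero _))
    rw [Fin.sum_univ_succ, Fin.sum_univ_succ, hW0, hW1]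
    simp only [hW2, WithLp.toLp_zero, norm_zero, ne_eq, OfNat.ofNat_ne_zero, not_false_eq_true,
      zero_pow, Finset.sum_const_zero, add_zero]
    have hR : ‖WithLp.toLp 2 a‖ ^ 2 + ‖WithLp.toLp 2 b‖ ^ 2
        ≤ ∑ i : Fin (N + 2), ‖WithLp.toLp 2 fun s => v (i, s)‖ ^ 2 := by
      rw [Fin.sum_univ_castSucc, Fin.sum_univ_castSucc]
      have : 0 ≤ ∑ i : Fin N, ‖WithLp.toLp 2 fun s => v (i.castSucc.castSucc, s)‖ ^ 2 := by
        positivity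
      linarith
    have h1 : ‖WithLp.toLp 2 (L *ᵥ a + (-2 : ℝ) • b)‖
        ≤ specNorm L * ‖WithLp.toLp 2 a‖ + 2 * ‖WithLp.toLp 2 b‖ := by
      rw [WithLp.toLp_add, WithLp.toLp_smul]
      refine (norm_add_le _ _).trans (add_le_add (norm_mulVec_le L a) ?_)
      rw [norm_smul]
      norm_num
    have h2 := norm_mulVec_le L b
    calc _ ≤ (specNorm L * ‖WithLp.toLp 2 a‖ + 2 * ‖WithLp.toLp 2 b‖) ^ 2
          + (specNorm L * ‖WithLp.toLp 2 b‖) ^ 2 := by gcongr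
      _ ≤ (Real.sqrt (specNorm L ^ 2 + 1) + 1) ^ 2
          * (‖WithLp.toLp 2 a‖ ^ 2 + ‖WithLp.toLp 2 b‖ ^ 2) := sq_add_sq_le_of_norm
      _ ≤ _ := by gcongr

theorem specNorm_blockY_le (m n : ℕ) : specNorm (blockY m n) ≤ 1 := by
  refine specNorm_le zero_le_one fun v => ?_
  rw [← energyNorm_transpose_mul_self, blockY_transpose, blockY_mul_self, one_mul]
  have := energyNorm_transpose_mul_self (1 : Matrix (Fin n × Fin m) (Fin n × Fin m) ℝ) v
  rw [transpose_one, Matrix.one_mul, one_mulVec] at this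
  exact this.le

/-- The real principal square root of `C_α` and its persymmetry. -/
theorem exists_real_sqrt {n : ℕ} (hn : n ≠ 0) {α : ℝ}
    (hα : α ∈ Set.Ioc (0 : ℝ) (1 / 2)) {L : Matrix (Fin m) (Fin m) ℝ} (hL : Lᵀ = L)
    {Q : Matrix (Fin m) (Fin m) ℂ} {l : Fin m → ℝ} (hQu : IsUnit Q.det) (hl : ∀ i, 1 < l i)
    (hQ : Q * L.map Complex.ofReal = diagonal (fun i => (l i : ℂ)) * Q) :
    ∃ R : Matrix (Fin n × Fin m) (Fin n × Fin m) ℝ, sqrtC n L α = R.map Complex.ofReal ∧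
      IsUnit R.det ∧ R * R = blockC n L α ∧ blockY m n * R * blockY m n = Rᵀ := by
  have hS := isPrincipalSqrt_sqrtC hn hα hQu hl hQ
  obtain ⟨z, hz, hX, hmem, hC⟩ := exists_diagonalization_blockCℂ hn hα hQu hl hQ
  obtain ⟨R, hR⟩ := exists_real_of_isPrincipalSqrt hX hmem hC hS
  have hinj : Function.Injective fun M : Matrix (Fin n × Fin m) (Fin n × Fin m) ℝ =>
      M.map Complex.ofRealHom := Matrix.map_injective Complex.ofReal_injective
  have hR' : sqrtC n L α = R.map Complex.ofRealHom := hR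
  refine ⟨R, hR, ?_, hinj ?_, hinj ?_⟩
  · have h1 := (inv_of_isPrincipalSqrt hX (fun p => Complex.slitPlane_ne_zero (hmem p)) hC hS).1
    rw [hR', ← RingHom.mapMatrix_apply, ← RingHom.map_det] at h1
    exact isUnit_iff_ne_zero.2 fun h0 => h1.ne_zero (by rw [h0, map_zero])
  · simp only [Matrix.map_mul, ← hR']
    exact hS.mul_self
  -- Y R Y and Rᵀ are principal square roots of the same matrix Y C_α Y = C_αᵀ, hence equal.
  · have hYc : (blockY m n).map Complex.ofRealHom * (blockY m n).map Complex.ofRealHom = 1 := by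
      rw [← Matrix.map_mul, blockY_mul_self, Matrix.map_one _ (map_zero _) (map_one _)]
    have h1 := hS.conj hYc
    have h2 := hS.transpose
    have h3 : (blockY m n).map Complex.ofRealHom * blockCℂ n L α
        * (blockY m n).map Complex.ofRealHom = (blockCℂ n L α)ᵀ := by
      change (blockY m n).map Complex.ofRealHom * (blockC n L α).map Complex.ofRealHom
        * (blockY m n).map Complex.ofRealHom = ((blockC n L α).map Complex.ofRealHom)ᵀ
      rw [← Matrix.map_mul, ← Matrix.map_mul, blockY_conj_blockC n hL, transpose_map]
    rw [h3] at h1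
    have h4 := h1.unique h2
    simp only [Matrix.map_mul, ← hR', transpose_map]
    exact h4

/-- Persymmetry gives Y R² = Rᵀ Y R, so C_α in place of T would be preconditioned to Y exactly; the
error is the wrap-around part. -/
theorem precond_eq_blockY_sub {n : ℕ} {L : Matrix (Fin m) (Fin m) ℝ} {α : ℝ}
    {R : Matrix (Fin n × Fin m) (Fin n × Fin m) ℝ} (hR : IsUnit R.det)
    (hRR : R * R = blockC n L α) (hY : blockY m n * R * blockY m n = Rᵀ) :
    R⁻¹ᵀ * (blockY m n * blockT n L) * R⁻¹
      = blockY m n - α • (R⁻¹ᵀ * (blockY m n * wrapW n L) * R⁻¹) := by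
  have hT : blockT n L = R * R - α • wrapW n L := by
    rw [hRR, blockC_eq_blockT_add, add_sub_cancel_right]
  have hYR : blockY m n * R = Rᵀ * blockY m n := by
    rw [← hY, Matrix.mul_assoc, blockY_mul_self, Matrix.mul_one]
  have hmain : R⁻¹ᵀ * (blockY m n * (R * R)) * R⁻¹ = blockY m n := by
    rw [← Matrix.mul_assoc (blockY m n), hYR]
    calc R⁻¹ᵀ * (Rᵀ * blockY m n * R) * R⁻¹
        = (R⁻¹ᵀ * Rᵀ) * blockY m n * (R * R⁻¹) := by simp only [Matrix.mul_assoc]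
      _ = _ := by
        rw [← transpose_mul, mul_nonsing_inv _ hR, transpose_one, Matrix.one_mul, Matrix.mul_one]
  rw [hT, Matrix.mul_sub, Matrix.mul_sub, Matrix.sub_mul, hmain]
  simp only [Matrix.mul_smul, Matrix.smul_mul]

/-- Y T is symmetric by the case α = 0 of `blockY_conj_blockC`, and Q is congruent to it. -/
theorem isHermitian_precond {n : ℕ} {L : Matrix (Fin m) (Fin m) ℝ} (hL : Lᵀ = L)
    (R : Matrix (Fin n × Fin m) (Fin n × Fin m) ℝ) :
    (R⁻¹ᵀ * (blockY m n * blockT n L) * R⁻¹).IsHermitian := by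
  have h : (blockY m n * blockT n L)ᵀ = blockY m n * blockT n L := by
    rw [transpose_mul, blockY_transpose, blockT, ← blockY_conj_blockC n hL, Matrix.mul_assoc,
      blockY_mul_self, Matrix.mul_one]
  rw [IsHermitian, conjTranspose_eq_transpose_of_trivial, transpose_mul, transpose_mul,
    transpose_transpose, h]
  simp only [Matrix.mul_assoc]

theorem specNorm_inv_sq_le_c0 {n : ℕ} {L : Matrix (Fin m) (Fin m) ℝ} {α : ℝ}
    (hα : α ∈ Set.Ioc (0 : ℝ) (1 / 2)) (hbdd : BddAbove (c0Set n L))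
    {R : Matrix (Fin n × Fin m) (Fin n × Fin m) ℝ} (hR : IsUnit R.det)
    (hS : sqrtC n L α = R.map Complex.ofReal) : specNorm R⁻¹ ^ 2 ≤ c0 n L := by
  have hinv : (sqrtC n L α)⁻¹ = R⁻¹.map Complex.ofReal := by
    refine inv_eq_right_inv ?_
    rw [hS]
    change R.map Complex.ofRealHom * R⁻¹.map Complex.ofRealHom = 1
    rw [← Matrix.map_mul, mul_nonsing_inv _ hR, Matrix.map_one _ (map_zero _) (map_one _)]
  refine le_trans ?_ (le_csSup hbdd ⟨α, hα, rfl⟩)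
  simp only [hinv]
  exact pow_le_pow_left₀ (specNorm_nonneg _) (specNorm_le_specNorm_ofReal _) 2

theorem norm_smul_wrap_mulVec_le {n : ℕ} (hn : n ≠ 0) {L : Matrix (Fin m) (Fin m) ℝ} {α : ℝ}
    (hα : α ∈ Set.Ioc (0 : ℝ) (1 / 2)) (hbdd : BddAbove (c0Set n L))
    {R : Matrix (Fin n × Fin m) (Fin n × Fin m) ℝ} (hR : IsUnit R.det)
    (hS : sqrtC n L α = R.map Complex.ofReal) (v : Fin n × Fin m → ℝ) :
    ‖WithLp.toLp 2 ((α • (R⁻¹ᵀ * (blockY m n * wrapW n L) * R⁻¹)) *ᵥ v)‖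
      ≤ α * c1 n L * ‖WithLp.toLp 2 v‖ := by
  refine (norm_mulVec_le _ v).trans ?_
  gcongr
  rw [specNorm_smul, Real.norm_of_nonneg hα.1.le]
  refine mul_le_mul_of_nonneg_left ?_ hα.1.le
  have h1 : specNorm (R⁻¹ᵀ) = specNorm R⁻¹ := by
    rw [← conjTranspose_eq_transpose_of_trivial, specNorm_conjTranspose]
  have h2 : specNorm (blockY m n * wrapW n L) ≤ Real.sqrt (specNorm L ^ 2 + 1) + 1 :=
    (specNorm_mul_le _ _).trans ((mul_le_mul (specNorm_blockY_le m n) (specNorm_wrapW_le hn L)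
      (specNorm_nonneg _) zero_le_one).trans (one_mul _).le)
  have h0 := specNorm_nonneg R⁻¹
  calc specNorm (R⁻¹ᵀ * (blockY m n * wrapW n L) * R⁻¹)
      ≤ specNorm R⁻¹ * (Real.sqrt (specNorm L ^ 2 + 1) + 1) * specNorm R⁻¹ := by
        refine (specNorm_mul_le _ _).trans (mul_le_mul_of_nonneg_right ?_ h0)
        refine (specNorm_mul_le _ _).trans ?_
        rw [h1]
        gcongr
    _ = specNorm R⁻¹ ^ 2 * (Real.sqrt (specNorm L ^ 2 + 1) + 1) := by ring
    _ ≤ c1 n L := by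
        rw [c1]
        gcongr
        exact specNorm_inv_sq_le_c0 hα hbdd hR hS

theorem c1_pos {n : ℕ} {L : Matrix (Fin m) (Fin m) ℝ} {α : ℝ} (hm : 0 < m) (hn : 0 < n)
    (hα : α ∈ Set.Ioc (0 : ℝ) (1 / 2)) (hbdd : BddAbove (c0Set n L))
    {R : Matrix (Fin n × Fin m) (Fin n × Fin m) ℝ} (hR : IsUnit R.det)
    (hS : sqrtC n L α = R.map Complex.ofReal) : 0 < c1 n L := by
  have : Nonempty (Fin n × Fin m) := ⟨(⟨0, hn⟩, ⟨0, hm⟩)⟩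
  have hne : R⁻¹ ≠ 0 := by
    intro h
    have h1 := mul_nonsing_inv R hR
    rw [h, Matrix.mul_zero] at h1
    exact zero_ne_one h1
  have h1 := specNorm_inv_sq_le_c0 hα hbdd hR hS
  have h2 := specNorm_pos hne
  have h3 : 0 < c0 n L := lt_of_lt_of_le (by positivity) h1
  rw [c1]
  positivity

end WaveMinres

end

/-! ### Main theorem -/

theorem theorem2p1 (ν : ℝ) (hν : ν ∈ Set.Ioo (0 : ℝ) 1)
    (m n : ℕ) (hm : 0 < m) (hn : 0 < n) (τ : ℝ) (hτ : 0 < τ)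
    (Δh : Matrix (Fin m) (Fin m) ℝ) (hΔ : (-Δh).PosDef)
    (L : Matrix (Fin m) (Fin m) ℝ) (hL : L = WaveMinres.waveL τ Δh) :
    -- the square roots exist, and the constants are finite and positive
    (∀ α ∈ Set.Ioc (0 : ℝ) (1 / 2),
      IsPrincipalSqrt (WaveMinres.blockCℂ n L α) (WaveMinres.sqrtC n L α) ∧
      IsUnit (WaveMinres.sqrtC n L α).det) ∧
    BddAbove (WaveMinres.c0Set n L) ∧
    0 < WaveMinres.c1 n L ∧
    ∀ α ∈ Set.Ioc (0 : ℝ) (WaveMinres.eta n L ν),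
      -- the preconditioner is real and symmetric positive definite
      (WaveMinres.precP n L α).map Complex.ofReal
        = (WaveMinres.sqrtC n L α)ᵀ * WaveMinres.sqrtC n L α ∧
      (WaveMinres.precP n L α).PosDef ∧
      -- the MINRES iterates are well defined and converge at the asserted rate
      ∀ (f u₀ : Fin n × Fin m → ℝ) (k : ℕ), 1 ≤ k →
        (∃! u, IsMinresIterate (WaveMinres.precP n L α)
          (WaveMinres.blockY m n * WaveMinres.blockT n L)
          (WaveMinres.blockY m n *ᵥ f) u₀ k u) ∧
        ∀ u, IsMinresIterate (WaveMinres.precP n L α)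
            (WaveMinres.blockY m n * WaveMinres.blockT n L)
            (WaveMinres.blockY m n *ᵥ f) u₀ k u →
          energyNorm (WaveMinres.precP n L α)
            (precResidual (WaveMinres.precP n L α)
              (WaveMinres.blockY m n * WaveMinres.blockT n L)
              (WaveMinres.blockY m n *ᵥ f) u)
          ≤ 2 * ν ^ (k - 1) *
            energyNorm (WaveMinres.precP n L α)
              (precResidual (WaveMinres.precP n L α)
                (WaveMinres.blockY m n * WaveMinres.blockT n L)
                (WaveMinres.blockY m n *ᵥ f) u₀) := by

  subst hL
  have hsymm : (WaveMinres.waveL τ Δh)ᵀ = WaveMinres.waveL τ Δh := by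
    have h := hΔ.1.eq
    rw [conjTranspose_eq_transpose_of_trivial, transpose_neg, neg_inj] at h
    rw [WaveMinres.waveL, transpose_sub, transpose_one, transpose_smul, h]
  obtain ⟨Q, l, hQu, hl, hQ⟩ := WaveMinres.exists_diagonalization_waveL hτ hΔ
  set L := WaveMinres.waveL τ Δh
  have hbdd := WaveMinres.bddAbove_c0Set hn.ne' hQu hl hQ
  have hreal := fun (α : ℝ) (hα : α ∈ Set.Ioc (0 : ℝ) (1 / 2)) =>
    WaveMinres.exists_real_sqrt hn.ne' hα hsymm hQu hl hQ
  have hc1 : 0 < WaveMinres.c1 n L := by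
    -- Any admissible parameter serves: one invertible root already makes the supremum c₀ positive.
    obtain ⟨R, hS, hR, -⟩ := hreal (1 / 2) ⟨by norm_num, le_rfl⟩
    exact WaveMinres.c1_pos hm hn ⟨by norm_num, le_rfl⟩ hbdd hR hS
  refine ⟨fun α hα => ⟨WaveMinres.isPrincipalSqrt_sqrtC hn.ne' hα hQu hl hQ, ?_⟩, hbdd, hc1,
    fun α hα => ?_⟩
  · obtain ⟨R, hS, hR, -⟩ := hreal α hα
    have h := hR.map Complex.ofRealHom
    rw [RingHom.map_det] at h
    rw [hS]
    exact h
  have hα' : α ∈ Set.Ioc (0 : ℝ) (1 / 2) := ⟨hα.1, hα.2.trans (min_le_right _ _)⟩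
  have hαc : α * WaveMinres.c1 n L ≤ ν ^ 2 :=
    (le_div_iff₀ hc1).1 (hα.2.trans (min_le_left _ _))
  obtain ⟨R, hS, hR, hRR, hY⟩ := hreal α hα'
  have hSS : (WaveMinres.sqrtC n L α)ᵀ * WaveMinres.sqrtC n L α
      = (Rᵀ * R).map Complex.ofReal := by
    rw [hS]
    change (R.map Complex.ofRealHom)ᵀ * R.map Complex.ofRealHom = (Rᵀ * R).map Complex.ofRealHom
    rw [Matrix.map_mul, transpose_map]
  have hP : WaveMinres.precP n L α = Rᵀ * R := by
    rw [WaveMinres.precP, hSS]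
    ext i j
    simp
  rw [hP]
  have hν2 : ν ^ 2 < 1 := pow_lt_one₀ hν.1.le hν.2 two_ne_zero
  have hYnorm : ∀ v : Fin n × Fin m → ℝ,
      ‖WithLp.toLp 2 (WaveMinres.blockY m n *ᵥ v)‖ = ‖WithLp.toLp 2 v‖ := fun v => by
    have h := energyNorm_transpose_mul_self (1 : Matrix (Fin n × Fin m) (Fin n × Fin m) ℝ) v
    rw [transpose_one, Matrix.one_mul, one_mulVec] at h
    rw [← energyNorm_transpose_mul_self, WaveMinres.blockY_transpose,
      WaveMinres.blockY_mul_self, h]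
  have hpert : ∀ v : Fin n × Fin m → ℝ, ‖WithLp.toLp 2 ((α • (R⁻¹ᵀ
      * (WaveMinres.blockY m n * WaveMinres.wrapW n L) * R⁻¹)) *ᵥ v)‖
      ≤ ν ^ 2 * ‖WithLp.toLp 2 v‖ := fun v =>
    (WaveMinres.norm_smul_wrap_mulVec_le hn.ne' hα' hbdd hR hS v).trans (by gcongr)
  have hQeq := WaveMinres.precond_eq_blockY_sub hR hRR hY
  -- Q is the isometry Y minus a term of norm at most ν², so both bounds are triangle inequalities.
  have hlow : ∀ v : Fin n × Fin m → ℝ, (1 - ν ^ 2) * ‖WithLp.toLp 2 v‖ ≤ ‖WithLp.toLp 2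
      ((R⁻¹ᵀ * (WaveMinres.blockY m n * WaveMinres.blockT n L) * R⁻¹) *ᵥ v)‖ := fun v => by
    rw [hQeq, sub_mulVec, WithLp.toLp_sub]
    have h := norm_sub_norm_le (WithLp.toLp 2 (WaveMinres.blockY m n *ᵥ v)) (WithLp.toLp 2 ((α • (R⁻¹ᵀ
      * (WaveMinres.blockY m n * WaveMinres.wrapW n L) * R⁻¹)) *ᵥ v))
    rw [hYnorm] at h
    linarith [hpert v]
  have hup : ∀ v : Fin n × Fin m → ℝ, ‖WithLp.toLp 2
      ((R⁻¹ᵀ * (WaveMinres.blockY m n * WaveMinres.blockT n L) * R⁻¹) *ᵥ v)‖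
      ≤ (1 + ν ^ 2) * ‖WithLp.toLp 2 v‖ := fun v => by
    rw [hQeq, sub_mulVec, WithLp.toLp_sub]
    have h := norm_sub_le (WithLp.toLp 2 (WaveMinres.blockY m n *ᵥ v)) (WithLp.toLp 2 ((α • (R⁻¹ᵀ
      * (WaveMinres.blockY m n * WaveMinres.wrapW n L) * R⁻¹)) *ᵥ v))
    rw [hYnorm] at h
    linarith [hpert v]
  refine ⟨hSS.symm, ?_, fun f u₀ k hk => ⟨existsUnique_isMinresIterate hR rfl hν2 hlow _ u₀ k,
    fun u hu => ?_⟩⟩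
  · have h := PosDef.conjTranspose_mul_self R (mulVec_injective_iff_isUnit.2
      ((isUnit_iff_isUnit_det R).2 hR))
    rwa [conjTranspose_eq_transpose_of_trivial] at h
  · refine (hu.energyNorm_precResidual_le hR rfl (WaveMinres.isHermitian_precond hsymm R)
      (pow_pos hν.1 2) hν2.le hlow hup hk).trans ?_
    -- Since 2⌊k/2⌋ ≥ k - 1, with equality for odd k; this is the origin of the exponent k - 1.
    have hpow : (ν ^ 2) ^ (k / 2) ≤ ν ^ (k - 1) := by
      rw [← pow_mul]
      exact pow_le_pow_of_le_one hν.1.le hν.2.le (by omega)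
    refine mul_le_mul_of_nonneg_right ?_ (Real.sqrt_nonneg _)
    linarith
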